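/- Let $d\ge 1$ and write $|x|_\infty=\max_l|x_l|$ for $x\in\mathbb Z^d$. Let $\mathcal B$ be the class of all complex matrices $A=(a(i,j))_{i,j\in\mathbb Z^d}$ with $$\|A\|_{\mathcal B}:=\sum_{k\in\mathbb Z^d}\ \sup_{|i-j|_\infty\ge|k|_\infty}|a(i,j)|<\infty .$$ For $1\le q<\infty$, a sequence $w=(w(i))_{i\in\mathbb Z^d}$ of positive numbers is a discrete $A_q$-weight if there is a constant $C>0$ such that for all $a\in\mathbb Z^d$ and all integers $N\ge1$, with $Q=a+\{0,\dots,N-1\}^d$, $$\Big(N^{-d}\sum_{i\in Q}w(i)\Big)\Big(N^{-d}\sum_{i\in Q}w(i)^{-1/(q-1)}\Big)^{q-1}\le C\quad\text{if }1<q<\infty,$$ $$N^{-d}\sum_{i\in Q}w(i)\le C\inf_{i\in Q}w(i)\quad\text{if }q=1.$$ Put $\|c\|_{q,w}=\big(\sum_{i\in\mathbb Z^d}|c(i)|^qw(i)\big)^{1/q}$ and let $\ell^q_w$ be the space of all complex sequences $c$ on $\mathbb Z^d$ with $\|c\|_{q,w}<\infty$. A matrix $A$ has $\ell^q_w$-stability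 if there is a constant $C>0$ such that, for every $c\in\ell^q_w$, the series $(Ac)(i)=\sum_j a(i,j)c(j)$ converge absolutely and $C^{-1}\|c\|_{q,w}\le\|Ac\|_{q,w}\le C\|c\|_{q,w}$. Let $1\le q<\infty$, let $w$ be a discrete $A_q$-weight, and let $A\in\mathcal B$. Then $A$ has $\ell^q_w$-stability if and only if there is a matrix $B\in\mathcal B$ with $BA=I$. Moreover, if $A$ has $\ell^q_w$-stability, then $A^*A$ has a two-sided inverse $(A^*A)^{-1}$ in $\mathcal B$, where $A^*=(\overline{a(j,i)})_{i,j}$ is the conjugate transpose, and the matrix $B=(A^*A)^{-1}A^*$ belongs to $\mathcal B$ and satisfies $BA=I$. -/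

import Mathlib

open scoped ENNReal NNReal Matrix

noncomputable section

namespace Beurling

/-- The lattice `ℤ^d`. Its norm `‖x‖` in Mathlib is the maximum norm `|x|_∞ = max_l |x_l|`. -/
abbrev Lattice (d : ℕ) : Type := Fin d → ℤ

/-- Infinite complex matrices `(a(i,j))` indexed by `ℤ^d × ℤ^d`. -/
abbrev InfMatrix (d : ℕ) : Type := Matrix (Lattice d) (Lattice d) ℂ

/-- `‖A‖_𝓑 = ∑_{k ∈ ℤ^d} sup_{|i-j|_∞ ≥ |k|_∞} |a(i,j)|`, a value in `[0,∞]`. -/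
def beurlingNorm {d : ℕ} (A : InfMatrix d) : ℝ≥0∞ :=
  ∑' k : Lattice d, ⨆ (i : Lattice d) (j : Lattice d) (_ : ‖k‖ ≤ ‖i - j‖), ‖A i j‖ₑ

/-- The class `𝓑(ℤ^d, ℤ^d)` of all matrices with `‖A‖_𝓑 < ∞`. -/
def beurlingClass (d : ℕ) : Set (InfMatrix d) := {A | beurlingNorm A < ∞}

/-- The discrete cube `a + [0, N-1]^d` in `ℤ^d`; it has `N^d` points. -/
def cube {d : ℕ} (a : Lattice d) (N : ℕ) : Finset (Lattice d) :=
  Finset.Icc a (fun l => a l + ((N : ℤ) - 1))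

/-- The average `N^{-d} ∑_{i ∈ a + [0,N-1]^d} f(i)`. -/
def cubeAvg {d : ℕ} (a : Lattice d) (N : ℕ) (f : Lattice d → ℝ) : ℝ :=
  ((N : ℝ) ^ d)⁻¹ * ∑ i ∈ cube a N, f i

/-- Discrete Muckenhoupt `A_q`-weights on `ℤ^d`, for `1 ≤ q < ∞`: positive sequences with
`(avg w) (avg w^{-1/(q-1)})^{q-1} ≤ C` on all cubes when `1 < q`, and with
`avg w ≤ C inf w` on all cubes when `q = 1`. -/
def IsAqWeight {d : ℕ} (q : ℝ) (w : Lattice d → ℝ) : Prop :=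
  (∀ i, 0 < w i) ∧
  (q = 1 → ∃ C : ℝ, 0 < C ∧ ∀ (a : Lattice d) (N : ℕ), 1 ≤ N →
    ∀ j ∈ cube a N, cubeAvg a N w ≤ C * w j) ∧
  (1 < q → ∃ C : ℝ, 0 < C ∧ ∀ (a : Lattice d) (N : ℕ), 1 ≤ N →
    cubeAvg a N w * (cubeAvg a N (fun i => w i ^ (-(1 / (q - 1))))) ^ (q - 1) ≤ C)

/-- `‖c‖_{q,w} = (∑_i |c(i)|^q w(i))^{1/q}`, a value in `[0,∞]`. -/
def weightedNorm {d : ℕ} (q : ℝ) (w : Lattice d → ℝ) (c : Lattice d → ℂ) : ℝ≥0∞ :=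
  (∑' i, ‖c i‖ₑ ^ q * ENNReal.ofReal (w i)) ^ (1 / q)

/-- The weighted sequence space `ℓ^q_w(ℤ^d)`. -/
def weightedSpace {d : ℕ} (q : ℝ) (w : Lattice d → ℝ) : Set (Lattice d → ℂ) :=
  {c | weightedNorm q w c < ∞}

/-- `(A c)(i) = ∑_j a(i,j) c(j)`. -/
def apply {d : ℕ} (A : InfMatrix d) (c : Lattice d → ℂ) : Lattice d → ℂ :=
  fun i => ∑' j, A i j * c j

/-- `A` has `ℓ^q_w`-stability: for some `C > 0` and all `c ∈ ℓ^q_w`, the sequence `A c` is defined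
and `C⁻¹ ‖c‖_{q,w} ≤ ‖A c‖_{q,w} ≤ C ‖c‖_{q,w}`. -/
def HasStability {d : ℕ} (q : ℝ) (w : Lattice d → ℝ) (A : InfMatrix d) : Prop :=
  ∃ C : ℝ≥0, 0 < C ∧ ∀ c ∈ weightedSpace q w,
    (∀ i, Summable (fun j => A i j * c j)) ∧
    (C : ℝ≥0∞)⁻¹ * weightedNorm q w c ≤ weightedNorm q w (apply A c) ∧
    weightedNorm q w (apply A c) ≤ (C : ℝ≥0∞) * weightedNorm q w c

/-- The product `A B` of infinite matrices; its defining series converge absolutely when both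
factors belong to `𝓑` (see `summable_mul`). -/
def mul {d : ℕ} (A B : InfMatrix d) : InfMatrix d :=
  fun i j => ∑' k, A i k * B k j

/-- `B A = I`, where the series defining the entries of `B A` are required to converge. -/
def IsLeftInverse {d : ℕ} (B A : InfMatrix d) : Prop :=
  ∀ i j, HasSum (fun k => B i k * A k j) ((1 : InfMatrix d) i j)

theorem summable_mul {d : ℕ} {A B : InfMatrix d} (hA : A ∈ beurlingClass d)
    (hB : B ∈ beurlingClass d) (i j : Lattice d) : Summable (fun k => A i k * B k j) := by
  have hb : ∀ k, ‖B k j‖ₑ ≤ beurlingNorm B := by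
    intro k
    refine le_trans ?_ (ENNReal.le_tsum (0 : Lattice d))
    exact le_iSup_of_le k (le_iSup_of_le j (le_iSup_of_le (by simp) le_rfl))
  have ha : ∑' k, ‖A i k‖ₑ ≤ beurlingNorm A := by
    rw [← (Equiv.subLeft i).tsum_eq (fun k => ‖A i k‖ₑ)]
    refine ENNReal.tsum_le_tsum fun k => ?_
    exact le_iSup_of_le i (le_iSup_of_le (i - k) (le_iSup_of_le (by simp) le_rfl))
  refine Summable.of_enorm (ne_of_lt ?_)
  calc ∑' k, ‖A i k * B k j‖ₑ ≤ ∑' k, ‖A i k‖ₑ * beurlingNorm B :=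
        ENNReal.tsum_le_tsum fun k => by
          rw [enorm_mul]
          gcongr
          exact hb k
    _ = (∑' k, ‖A i k‖ₑ) * beurlingNorm B := ENNReal.tsum_mul_right
    _ < ∞ := ENNReal.mul_lt_top (lt_of_le_of_lt ha hA) hB

end Beurling

end

/-! The heart of the proof is a localization principle: a lower bound for `A` on finitely supported
sequences, in one space `ℓ^q_w`, already forces a pointwise inequality `|c(i)| ≤ ∑_j H(i,j)
|(Ac)(j)|` for all bounded `c`, where `H` has finite Beurling norm and no weight appears
(`exists_kernel_pointwise_le`).

To obtain it, test stability on `c` times a Lipschitz cutoff at scale `N` around a cell. The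
commutator of `A` with the cutoff has Beurling norm tending to `0` as `N → ∞`, and so does the
interaction with distant cells. The local weighted norms of `c`, divided by the `1/q`-th power of
the weight of the cell, then satisfy `α ≤ β + Vα`, where `β` comes from `Ac` and `V` is a kernel of
small Beurling norm. The Muckenhoupt condition removes the weight: it bounds plain sums over a cell
by normalized weighted norms, and it makes the weights of neighbouring cells comparable. Kernels of
finite Beurling norm form an algebra up to a constant, so the Neumann series of `V` converges among
them and solves the inequality.

The principle is used twice. For `A` in `ℓ^q_w` it transfers the lower bound to unweighted `ℓ^2`,
where `A^*A` becomes a positive invertible operator. For `A^*A` in `ℓ^2` it is applied to the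
columns of the inverse `G`: these are mapped to unit vectors, so `|G(i,j)| ≤ H(i,j)` and `G` lies in
the Beurling class. Then `GA^*` is a left inverse of `A`.

Conversely, matrices of the class are bounded on `ℓ^q_w` (`tsum_act_rpow_le`), since a radial
decreasing majorant is a superposition of averages over cubes. Boundedness of `A` and of its left
inverse gives both stability bounds. -/

open scoped ENNReal NNReal Matrix
open Filter Topology

noncomputable section

namespace Beurling

variable {d : ℕ}

/-! ### The maximum norm on the lattice with values in `ℕ` -/

/-- The maximum norm of a lattice point as a natural number. -/
def size (x : Lattice d) : ℕ := Finset.univ.sup fun l => (x l).natAbs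

theorem size_le_iff {x : Lattice d} {n : ℕ} : size x ≤ n ↔ ∀ l, (x l).natAbs ≤ n := by
  simp [size]

theorem natAbs_le_size (x : Lattice d) (l : Fin d) : (x l).natAbs ≤ size x :=
  size_le_iff.1 le_rfl l

theorem norm_eq_size (x : Lattice d) : ‖x‖ = size x := by
  apply le_antisymm
  · refine (pi_norm_le_iff_of_nonneg (Nat.cast_nonneg _)).2 fun l => ?_
    rw [Int.norm_eq_abs, ← Int.cast_abs, Int.abs_eq_natAbs]
    exact_mod_cast natAbs_le_size x l
  · have h : size x ≤ ⌊‖x‖⌋₊ := size_le_iff.2 fun l => by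
      refine Nat.le_floor ?_
      refine le_trans (le_of_eq ?_) (norm_le_pi_norm x l)
      rw [Int.norm_eq_abs, ← Int.cast_abs, Int.abs_eq_natAbs]
      simp
    exact (Nat.le_floor_iff (norm_nonneg _)).1 h

theorem size_zero : size (0 : Lattice d) = 0 :=
  Nat.le_zero.1 (size_le_iff.2 fun l => by simp)

theorem size_eq_zero {x : Lattice d} : size x = 0 ↔ x = 0 := by
  constructor
  · intro h
    funext l
    have := natAbs_le_size x l
    simp only [Pi.zero_apply]
    omega
  · rintro rfl
    exact size_zero

theorem size_add_le (x y : Lattice d) : size (x + y) ≤ size x + size y :=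
  size_le_iff.2 fun l => by
    have h1 := natAbs_le_size x l
    have h2 := natAbs_le_size y l
    simp only [Pi.add_apply]
    omega

theorem size_sub_comm (x y : Lattice d) : size (x - y) = size (y - x) := by
  unfold size
  congr 1
  funext l
  simp only [Pi.sub_apply]
  omega

theorem size_sub_le (x y z : Lattice d) : size (x - z) ≤ size (x - y) + size (y - z) := by
  simpa using size_add_le (x - y) (y - z)

theorem le_size_of_coord {n : ℕ} {x : Lattice d} {l : Fin d} (h : n ≤ (x l).natAbs) : n ≤ size x :=
  h.trans (natAbs_le_size x l)

theorem exists_coord_of_lt_size {n : ℕ} {x : Lattice d} (h : n < size x) :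
    ∃ l, n < (x l).natAbs := by
  by_contra! hc
  exact absurd (size_le_iff.2 hc) (not_le.2 h)

/-- Rescaling the argument of a radial function costs a dimensional factor. -/
theorem tsum_size_div_le (h : ℕ → ℝ≥0∞) {M : ℕ} (hM : 1 ≤ M) :
    ∑' x : Lattice d, h (size x / M) ≤ ((2 * M : ℕ) : ℝ≥0∞) ^ d * ∑' y : Lattice d, h (size y) := by
  -- Division truncated towards zero commutes with absolute values, so `size` is divided exactly;
  -- floor division would break this at negative coordinates.
  let φ : Lattice d → Lattice d := fun x l => (x l).tdiv M
  have hφ : ∀ x, size (φ x) = size x / M := by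
    intro x
    apply le_antisymm
    · refine size_le_iff.2 fun l => ?_
      have : (φ x l).natAbs = (x l).natAbs / M := Int.natAbs_tdiv _ _
      rw [this]
      exact Nat.div_le_div_right (natAbs_le_size x l)
    · by_contra! hlt
      have h2 : (size (φ x) + 1) * M ≤ size x := (Nat.le_div_iff_mul_le hM).1 hlt
      have h3 : size x ≤ (size (φ x) + 1) * M - 1 := size_le_iff.2 fun l => by
        have h4 : (x l).natAbs / M ≤ size (φ x) := by
          have : (φ x l).natAbs = (x l).natAbs / M := Int.natAbs_tdiv _ _
          rw [← this]
          exact natAbs_le_size _ l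
        have := (Nat.div_lt_iff_lt_mul (by omega : 0 < M)).1 (Nat.lt_succ_of_le h4)
        simp only [Nat.succ_eq_add_one] at this
        omega
      have : 0 < (size (φ x) + 1) * M := by positivity
      omega
  have hr : ∀ (x : Lattice d) (l : Fin d), ((x l).tmod M + M).toNat < 2 * M := fun x l => by
    have := Int.tmod_lt_of_pos (x l) (by omega : (0 : ℤ) < M)
    omega
  -- Truncated remainders lie strictly between `-M` and `M`; shifting by `M` leaves at most `2 * M`
  -- values per coordinate, hence the factor `(2 * M) ^ d`.
  let e : Lattice d → Lattice d × (Fin d → Fin (2 * M)) :=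
    fun x => (φ x, fun l => ⟨((x l).tmod M + M).toNat, hr x l⟩)
  have he : Function.Injective e := by
    intro x y hxy
    have h1 := congrArg Prod.fst hxy
    have h2 := congrArg Prod.snd hxy
    funext l
    have h1 : (x l).tdiv M = (y l).tdiv M := congrFun h1 l
    have h2 : ((x l).tmod M + M).toNat = ((y l).tmod M + M).toNat :=
      congrArg Fin.val (congrFun h2 l)
    have h5 := Int.lt_tmod_of_pos (x l) (by omega : (0 : ℤ) < M)
    have h6 := Int.lt_tmod_of_pos (y l) (by omega : (0 : ℤ) < M)
    rw [← Int.tmod_add_mul_tdiv (x l) M, ← Int.tmod_add_mul_tdiv (y l) M, h1]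
    omega
  calc ∑' x : Lattice d, h (size x / M) = ∑' x, h (size (e x).1) := by
        simp only [e, hφ]
    _ ≤ ∑' p : Lattice d × (Fin d → Fin (2 * M)), h (size p.1) :=
        ENNReal.tsum_comp_le_tsum_of_injective he fun p => h (size p.1)
    _ = ((2 * M : ℕ) : ℝ≥0∞) ^ d * ∑' y : Lattice d, h (size y) := by
        rw [ENNReal.tsum_prod (f := fun (y : Lattice d) _ => h (size y))]
        simp [ENNReal.tsum_mul_left]

/-! ### Nonnegative kernels with radially summable majorant -/

/-- The least radially nonincreasing majorant of a kernel. -/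
def tail (F : Lattice d → Lattice d → ℝ≥0∞) (m : ℕ) : ℝ≥0∞ :=
  ⨆ (i : Lattice d) (j : Lattice d) (_ : m ≤ size (i - j)), F i j

/-- The Beurling norm of a nonnegative kernel. -/
def kernelNorm (F : Lattice d → Lattice d → ℝ≥0∞) : ℝ≥0∞ := ∑' k : Lattice d, tail F (size k)

theorem beurlingNorm_eq (A : InfMatrix d) : beurlingNorm A = kernelNorm fun i j => ‖A i j‖ₑ := by
  simp only [beurlingNorm, kernelNorm, tail, norm_eq_size, Nat.cast_le]

theorem le_tail (F : Lattice d → Lattice d → ℝ≥0∞) {i j : Lattice d} {m : ℕ}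
    (h : m ≤ size (i - j)) : F i j ≤ tail F m :=
  le_iSup_of_le i (le_iSup_of_le j (le_iSup_of_le h le_rfl))

theorem tail_le {F : Lattice d → Lattice d → ℝ≥0∞} {m : ℕ} {b : ℝ≥0∞}
    (h : ∀ i j, m ≤ size (i - j) → F i j ≤ b) : tail F m ≤ b :=
  iSup_le fun i => iSup_le fun j => iSup_le fun hm => h i j hm

theorem tail_antitone (F : Lattice d → Lattice d → ℝ≥0∞) : Antitone (tail F) :=
  fun _ _ h => tail_le fun _ _ hij => le_tail F (h.trans hij)

theorem kernelNorm_le_tsum {F : Lattice d → Lattice d → ℝ≥0∞} {h : ℕ → ℝ≥0∞} (hh : Antitone h)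
    (hF : ∀ i j, F i j ≤ h (size (i - j))) : kernelNorm F ≤ ∑' k : Lattice d, h (size k) :=
  ENNReal.tsum_le_tsum fun _ => tail_le fun i j hij => (hF i j).trans (hh hij)

theorem kernelNorm_mono {F G : Lattice d → Lattice d → ℝ≥0∞} (h : ∀ i j, F i j ≤ G i j) :
    kernelNorm F ≤ kernelNorm G :=
  kernelNorm_le_tsum (tail_antitone G) fun i j => (h i j).trans (le_tail G le_rfl)

theorem tsum_size_sub_left (h : ℕ → ℝ≥0∞) (i : Lattice d) :
    ∑' j : Lattice d, h (size (i - j)) = ∑' k : Lattice d, h (size k) :=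
  (Equiv.subLeft i).tsum_eq fun k => h (size k)

theorem tsum_size_sub_right (h : ℕ → ℝ≥0∞) (j : Lattice d) :
    ∑' i : Lattice d, h (size (i - j)) = ∑' k : Lattice d, h (size k) :=
  (Equiv.subRight j).tsum_eq fun k => h (size k)

theorem tsum_row_le (F : Lattice d → Lattice d → ℝ≥0∞) (i : Lattice d) :
    ∑' j, F i j ≤ kernelNorm F := by
  rw [kernelNorm, ← tsum_size_sub_left (tail F) i]
  exact ENNReal.tsum_le_tsum fun j => le_tail F le_rfl

theorem kernelNorm_tsum_le (F : ℕ → Lattice d → Lattice d → ℝ≥0∞) :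
    kernelNorm (fun i j => ∑' l, F l i j) ≤ ∑' l, kernelNorm (F l) := by
  unfold kernelNorm
  rw [ENNReal.tsum_comm]
  refine ENNReal.tsum_le_tsum fun k => tail_le fun i j hij => ?_
  exact ENNReal.tsum_le_tsum fun l => le_tail (F l) hij

theorem kernelNorm_const_mul_le (c : ℝ≥0∞) (F : Lattice d → Lattice d → ℝ≥0∞) :
    kernelNorm (fun i j => c * F i j) ≤ c * kernelNorm F := by
  unfold kernelNorm
  rw [← ENNReal.tsum_mul_left]
  refine ENNReal.tsum_le_tsum fun k => tail_le fun i j hij => ?_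
  gcongr
  exact le_tail F hij

/-- The action of a nonnegative kernel on a nonnegative sequence. -/
def act (F : Lattice d → Lattice d → ℝ≥0∞) (f : Lattice d → ℝ≥0∞) (i : Lattice d) : ℝ≥0∞ :=
  ∑' j, F i j * f j

/-- Composition of nonnegative kernels. -/
def comp (F G : Lattice d → Lattice d → ℝ≥0∞) (i j : Lattice d) : ℝ≥0∞ := ∑' k, F i k * G k j

theorem act_mono (F : Lattice d → Lattice d → ℝ≥0∞) {f g : Lattice d → ℝ≥0∞} (h : ∀ i, f i ≤ g i)
    (i : Lattice d) : act F f i ≤ act F g i :=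
  ENNReal.tsum_le_tsum fun j => by gcongr; exact h j

theorem act_comp (F G : Lattice d → Lattice d → ℝ≥0∞) (f : Lattice d → ℝ≥0∞) (i : Lattice d) :
    act (comp F G) f i = act F (act G f) i := by
  simp only [act, comp, ← ENNReal.tsum_mul_left, ← ENNReal.tsum_mul_right]
  rw [ENNReal.tsum_comm]
  simp only [mul_assoc]

/-- If `i` and `j` are at distance at least `r`, any intermediate `k` is at distance at least `r /
2` from one of them. That factor contributes its tail at `r / 2`, the other is summed out, and
rescaling by `2` costs `4 ^ d` for each of the two cases. -/
theorem kernelNorm_comp_le (F G : Lattice d → Lattice d → ℝ≥0∞) :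
    kernelNorm (comp F G) ≤ (2 * 4 ^ d) * kernelNorm F * kernelNorm G := by
  have key : ∀ r, tail (comp F G) r ≤
      tail F (r / 2) * kernelNorm G + kernelNorm F * tail G (r / 2) := by
    intro r
    refine tail_le fun i j hij => ?_
    rw [kernelNorm, kernelNorm, ← tsum_size_sub_left (tail F) i, ← tsum_size_sub_right (tail G) j,
      ← ENNReal.tsum_mul_left, ← ENNReal.tsum_mul_right, ← ENNReal.tsum_add]
    refine ENNReal.tsum_le_tsum fun k => ?_
    have h := size_sub_le i k j
    rcases (by omega : r / 2 ≤ size (i - k) ∨ r / 2 ≤ size (k - j)) with h1 | h1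
    · exact le_trans (mul_le_mul' (le_tail F h1) (le_tail G le_rfl)) le_self_add
    · exact le_trans (mul_le_mul' (le_tail F le_rfl) (le_tail G h1)) le_add_self
  calc kernelNorm (comp F G)
      ≤ ∑' k : Lattice d, (tail F (size k / 2) * kernelNorm G +
          kernelNorm F * tail G (size k / 2)) := ENNReal.tsum_le_tsum fun k => key _
    _ ≤ (4 ^ d * kernelNorm F) * kernelNorm G + kernelNorm F * (4 ^ d * kernelNorm G) := by
        rw [ENNReal.tsum_add, ENNReal.tsum_mul_left, ENNReal.tsum_mul_right]
        have h1 := tsum_size_div_le (d := d) (tail F) one_le_two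
        have h2 := tsum_size_div_le (d := d) (tail G) one_le_two
        norm_num at h1 h2
        gcongr
        · exact h1
        · exact h2
    _ = (2 * 4 ^ d) * kernelNorm F * kernelNorm G := by ring

/-- Powers of a nonnegative kernel. -/
def kpow (F : Lattice d → Lattice d → ℝ≥0∞) : ℕ → Lattice d → Lattice d → ℝ≥0∞
  | 0 => fun i j => if i = j then 1 else 0
  | l + 1 => comp (kpow F l) F

theorem act_kpow_zero (F : Lattice d → Lattice d → ℝ≥0∞) (f : Lattice d → ℝ≥0∞) (i : Lattice d) :
    act (kpow F 0) f i = f i := by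
  unfold act
  rw [tsum_eq_single i]
  · simp [kpow]
  · intro j hj
    simp [kpow, hj.symm]

theorem kernelNorm_kpow_le (F : Lattice d → Lattice d → ℝ≥0∞) (l : ℕ) :
    kernelNorm (kpow F l) ≤ ((2 * 4 ^ d) * kernelNorm F) ^ l := by
  induction l with
  | zero =>
    refine (kernelNorm_le_tsum (h := fun m => if m = 0 then 1 else 0) ?_ ?_).trans ?_
    · intro m n hmn
      by_cases hm : m = 0
      · simp only [hm, if_true]
        split_ifs <;> simp
      · simp [hm, show n ≠ 0 by omega]
    · intro i j
      by_cases h : i = j <;> simp [kpow, h, size_eq_zero, sub_eq_zero]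
    · simp [size_eq_zero]
  | succ l ih =>
    calc kernelNorm (kpow F (l + 1)) ≤ (2 * 4 ^ d) * kernelNorm (kpow F l) * kernelNorm F :=
          kernelNorm_comp_le _ _
      _ ≤ (2 * 4 ^ d) * ((2 * 4 ^ d) * kernelNorm F) ^ l * kernelNorm F := by gcongr
      _ = ((2 * 4 ^ d) * kernelNorm F) ^ (l + 1) := by ring

/-- The Neumann series of a nonnegative kernel. -/
def neumann (F : Lattice d → Lattice d → ℝ≥0∞) (i j : Lattice d) : ℝ≥0∞ := ∑' l, kpow F l i j

theorem kernelNorm_neumann_lt_top {F : Lattice d → Lattice d → ℝ≥0∞}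
    (hF : (2 * 4 ^ d) * kernelNorm F ≤ 2⁻¹) : kernelNorm (neumann F) < ∞ := by
  refine lt_of_le_of_lt (kernelNorm_tsum_le _) ?_
  refine lt_of_le_of_lt (ENNReal.tsum_le_tsum fun l => (kernelNorm_kpow_le F l).trans
    (pow_le_pow_left' hF l)) ?_
  rw [ENNReal.tsum_geometric]
  simp

/-- A bounded solution of `α ≤ β + F α` is dominated by the Neumann series applied to `β`. -/
theorem le_act_neumann {F : Lattice d → Lattice d → ℝ≥0∞}
    (hF : (2 * 4 ^ d) * kernelNorm F ≤ 2⁻¹) {α β : Lattice d → ℝ≥0∞} {M : ℝ≥0∞} (hM : M ≠ ∞)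
    (hα : ∀ i, α i ≤ M) (h : ∀ i, α i ≤ β i + act F α i) (i : Lattice d) :
    α i ≤ act (neumann F) β i := by
  have step : ∀ L i, α i ≤ ∑ l ∈ Finset.range L, act (kpow F l) β i + act (kpow F L) α i := by
    intro L
    induction L with
    | zero => intro i; simp [act_kpow_zero]
    | succ L ih =>
      intro i
      refine (ih i).trans ?_
      rw [Finset.sum_range_succ, add_assoc]
      gcongr
      calc act (kpow F L) α i ≤ act (kpow F L) (fun i => β i + act F α i) i := act_mono _ h i
        _ = act (kpow F L) β i + act (kpow F L) (act F α) i := by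
            simp only [act, mul_add]
            rw [ENNReal.tsum_add]
        _ = act (kpow F L) β i + act (kpow F (L + 1)) α i := by
            rw [kpow, act_comp]
  have hsum : ∀ L, ∑ l ∈ Finset.range L, act (kpow F l) β i ≤ act (neumann F) β i := by
    intro L
    refine (ENNReal.sum_le_tsum _).trans (le_of_eq ?_)
    simp only [act, neumann, ← ENNReal.tsum_mul_right]
    rw [ENNReal.tsum_comm]
  -- Boundedness of `α` enters only here, to make the remainder of the iteration vanish; the
  -- constant sequence `∞` shows that it cannot be dropped.
  have hrest : ∀ L, act (kpow F L) α i ≤ M * 2⁻¹ ^ L := by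
    intro L
    calc act (kpow F L) α i ≤ ∑' j, kpow F L i j * M :=
          ENNReal.tsum_le_tsum fun j => by gcongr; exact hα j
      _ = M * ∑' j, kpow F L i j := by rw [ENNReal.tsum_mul_right, mul_comm]
      _ ≤ M * 2⁻¹ ^ L := by
          gcongr
          exact (tsum_row_le _ _).trans ((kernelNorm_kpow_le F L).trans (pow_le_pow_left' hF L))
  have hlim : Tendsto (fun L : ℕ => act (neumann F) β i + M * (2⁻¹ : ℝ≥0∞) ^ L) atTop
      (𝓝 (act (neumann F) β i + M * 0)) := by
    refine tendsto_const_nhds.add (ENNReal.Tendsto.const_mul ?_ (Or.inr hM))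
    exact ENNReal.tendsto_pow_atTop_nhds_zero_of_lt_one (by simp)
  rw [mul_zero, add_zero] at hlim
  exact ge_of_tendsto' hlim fun L => (step L i).trans (add_le_add (hsum L) (hrest L))

/-- Dominated convergence to zero for series in `[0, ∞]`. -/
theorem tendsto_tsum_zero {ι : Type*} {F : ℕ → ι → ℝ≥0∞} (b : ι → ℝ≥0∞) (hb : ∑' i, b i ≠ ∞)
    (hF : ∀ n i, F n i ≤ b i) (h : ∀ i, Tendsto (fun n => F n i) atTop (𝓝 0)) :
    Tendsto (fun n => ∑' i, F n i) atTop (𝓝 0) := by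
  let _ : MeasurableSpace ι := ⊤
  have := MeasureTheory.tendsto_lintegral_of_dominated_convergence
    (μ := MeasureTheory.Measure.count) (F := F) (f := fun _ => 0) b (fun n => measurable_from_top)
    (fun n => Eventually.of_forall (hF n)) (by rwa [MeasureTheory.lintegral_count])
    (Eventually.of_forall h)
  simpa [MeasureTheory.lintegral_count] using this

theorem tail_tendsto_zero (hd : 1 ≤ d) {F : Lattice d → Lattice d → ℝ≥0∞} (hF : kernelNorm F < ∞) :
    Tendsto (tail F) atTop (𝓝 0) := by
  have h := ENNReal.tendsto_cofinite_zero_of_tsum_ne_top hF.ne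
  -- The diagonal visits every size once, so summability over the lattice forces decay in `m`.
  let e : ℕ → Lattice d := fun m _ => m
  have he : Function.Injective e := fun m n hmn => by
    have := congrFun hmn ⟨0, hd⟩
    simpa [e] using this
  have h2 := h.comp he.tendsto_cofinite
  rw [Nat.cofinite_eq_atTop] at h2
  refine h2.congr fun m => ?_
  change tail F (size (e m)) = tail F m
  congr 1
  apply le_antisymm
  · exact size_le_iff.2 fun l => by simp [e]
  · exact le_size_of_coord (l := ⟨0, hd⟩) (by simp [e])

/-! ### Cells and windows -/

theorem mem_cube {a i : Lattice d} {N : ℕ} :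
    i ∈ cube a N ↔ ∀ l, a l ≤ i l ∧ i l ≤ a l + ((N : ℤ) - 1) := by
  simp [cube, Finset.mem_Icc, Pi.le_def, forall_and]

theorem card_cube (a : Lattice d) (N : ℕ) : (cube a N).card = N ^ d := by
  rw [cube, Pi.card_Icc]
  simp only [Int.card_Icc]
  have : ∀ l, (a l + ((N : ℤ) - 1) + 1 - a l).toNat = N := fun l => by omega
  simp [this]

/-- The index of the cell of side `N` that contains a lattice point. -/
def cell (N : ℕ) (i : Lattice d) : Lattice d := fun l => i l / (N : ℤ)

/-- The union of the cells of side `N` whose index has distance at most `R` from `n`. -/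
def window (N : ℕ) (n : Lattice d) (R : ℕ) : Finset (Lattice d) :=
  cube (fun l => (n l - R) * N) ((2 * R + 1) * N)

/-- A window is at once a ball of cells and a single cube of side `(2 * R + 1) * N`, so the
Muckenhoupt condition applies to it directly. -/
theorem mem_window {N : ℕ} (hN : 1 ≤ N) {n i : Lattice d} {R : ℕ} :
    i ∈ window N n R ↔ size (cell N i - n) ≤ R := by
  rw [window, mem_cube, size_le_iff]
  refine forall_congr' fun l => ?_
  have hN' : (0 : ℤ) < N := by omega
  have h1 : (n l - R) * N ≤ i l ↔ n l - R ≤ i l / N := (Int.le_ediv_iff_mul_le hN').symm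
  have h2 : i l < (n l + R + 1) * N ↔ i l / N < n l + R + 1 := (Int.ediv_lt_iff_lt_mul hN').symm
  have h3 : (n l - R) * (N : ℤ) + (((2 * R + 1) * N : ℕ) - 1 : ℤ) = (n l + R + 1) * N - 1 := by
    push_cast
    ring
  rw [h3, Int.le_sub_one_iff, h1, h2]
  simp only [cell, Pi.sub_apply]
  omega

theorem mem_window_zero {N : ℕ} (hN : 1 ≤ N) {n i : Lattice d} :
    i ∈ window N n 0 ↔ cell N i = n := by
  rw [mem_window hN, Nat.le_zero, size_eq_zero, sub_eq_zero]

theorem window_mono {N : ℕ} (hN : 1 ≤ N) (n : Lattice d) {R R' : ℕ} (h : R ≤ R') :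
    window N n R ⊆ window N n R' := fun _ hi =>
  (mem_window hN).2 (((mem_window hN).1 hi).trans h)

/-- Windows of scale `1` serve as balls in the lattice of cell indices. -/
theorem mem_ball_iff {n m : Lattice d} {R : ℕ} :
    m ∈ window 1 n R ↔ size (m - n) ≤ R := by
  have h : cell 1 m = m := by
    funext l
    simp [cell]
  rw [mem_window le_rfl, h]

theorem sum_eq_tsum_ite {ι : Type*} [DecidableEq ι] (s : Finset ι) (f : ι → ℝ≥0∞) :
    ∑ i ∈ s, f i = ∑' i, if i ∈ s then f i else 0 := by
  rw [tsum_eq_sum (s := s) fun _ hi => if_neg hi]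
  exact Finset.sum_congr rfl fun _ hi => (if_pos hi).symm

theorem tsum_ball (R : ℕ) (n : Lattice d) (c : ℝ≥0∞) :
    ∑' m : Lattice d, (if size (n - m) ≤ R then c else 0) = ((2 * R + 1 : ℕ) : ℝ≥0∞) ^ d * c := by
  have h : ∀ m, (if size (n - m) ≤ R then c else 0) = if m ∈ window 1 n R then c else 0 :=
    fun m => if_congr (by rw [mem_ball_iff, size_sub_comm n m]) rfl rfl
  rw [tsum_congr h, ← sum_eq_tsum_ite, Finset.sum_const, window, card_cube]
  simp

theorem tsum_window {N : ℕ} (hN : 1 ≤ N) (R : ℕ) (f : Lattice d → ℝ≥0∞) :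
    ∑' n, ∑ i ∈ window N n R, f i = ((2 * R + 1 : ℕ) : ℝ≥0∞) ^ d * ∑' i, f i := by
  simp only [sum_eq_tsum_ite, mem_window hN]
  rw [ENNReal.tsum_comm, ← ENNReal.tsum_mul_left]
  exact tsum_congr fun i => tsum_ball R (cell N i) (f i)

theorem tsum_cell {N : ℕ} (hN : 1 ≤ N) (f : Lattice d → ℝ≥0∞) :
    ∑' i, f i = ∑' n, ∑ i ∈ window N n 0, f i := by
  rw [tsum_window hN]
  simp

/-- Distances between cells, from above. -/
theorem size_cell_sub_le {N : ℕ} (hN : 1 ≤ N) (i j : Lattice d) :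
    size (cell N i - cell N j) ≤ size (i - j) / N + 1 := by
  refine size_le_iff.2 fun l => ?_
  have h := natAbs_le_size (i - j) l
  have hN' : (0 : ℤ) < N := by omega
  set s := size (i - j)
  have h0 := Nat.div_add_mod s N
  have h00 := Nat.mod_lt s (by omega : N > 0)
  have h1 := Int.emod_add_mul_ediv (i l) N
  have h2 := Int.emod_add_mul_ediv (j l) N
  have h3 := Int.emod_nonneg (i l) hN'.ne'
  have h4 := Int.emod_nonneg (j l) hN'.ne'
  have h5 := Int.emod_lt_of_pos (i l) hN'
  have h6 := Int.emod_lt_of_pos (j l) hN'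
  simp only [cell, Pi.sub_apply] at h ⊢
  zify at h0 h00
  set a := i l / (N : ℤ)
  set b := j l / (N : ℤ)
  have h7 : |i l - j l| ≤ (s : ℤ) := by rw [Int.abs_eq_natAbs]; exact_mod_cast h
  rw [abs_le] at h7
  have h8 : (N : ℤ) * (a - b) < N * ((s : ℤ) / N + 2) := by nlinarith
  have h9 : (N : ℤ) * (b - a) < N * ((s : ℤ) / N + 2) := by nlinarith
  have h10 := lt_of_mul_lt_mul_left h8 hN'.le
  have h11 := lt_of_mul_lt_mul_left h9 hN'.le
  have : ((s / N : ℕ) : ℤ) = (s : ℤ) / N := by simp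
  omega

/-- Distances between cells, from below. -/
theorem le_size_cell_sub {N : ℕ} (hN : 1 ≤ N) (i j : Lattice d) :
    size (i - j) / N ≤ size (cell N i - cell N j) := by
  by_contra! hlt
  have hN' : (0 : ℤ) < N := by omega
  rw [Nat.lt_iff_add_one_le, Nat.le_div_iff_mul_le hN] at hlt
  have hpos : 0 < (size (cell N i - cell N j) + 1) * N := by positivity
  obtain ⟨l, hl⟩ := exists_coord_of_lt_size (lt_of_lt_of_le (Nat.sub_one_lt hpos.ne') hlt)
  have h := natAbs_le_size (cell N i - cell N j) l
  set s := size (cell N i - cell N j)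
  have h1 := Int.emod_add_mul_ediv (i l) N
  have h2 := Int.emod_add_mul_ediv (j l) N
  have h3 := Int.emod_nonneg (i l) hN'.ne'
  have h4 := Int.emod_nonneg (j l) hN'.ne'
  have h5 := Int.emod_lt_of_pos (i l) hN'
  have h6 := Int.emod_lt_of_pos (j l) hN'
  simp only [cell, Pi.sub_apply] at h hl
  set a := i l / (N : ℤ)
  set b := j l / (N : ℤ)
  have h7 : |a - b| ≤ (s : ℤ) := by rw [Int.abs_eq_natAbs]; exact_mod_cast h
  have h8 : ((s : ℤ) + 1) * N ≤ |i l - j l| := by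
    rw [Int.abs_eq_natAbs]
    have : (s + 1) * N ≤ (i l - j l).natAbs := by omega
    exact_mod_cast this
  rw [abs_le] at h7
  rcases le_abs.1 h8 with h9 | h9 <;> nlinarith

/-! ### Muckenhoupt weights -/

/-- The Hölder form of the Muckenhoupt condition, with constant `C`. -/
def HasMuckenhouptBound (q : ℝ) (W : Lattice d → ℝ≥0∞) (C : ℝ≥0∞) : Prop :=
  ∀ (a : Lattice d) (N : ℕ), 1 ≤ N → ∀ f : Lattice d → ℝ≥0∞,
    (∑ i ∈ cube a N, f i) ^ q * ∑ i ∈ cube a N, W i ≤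
      C * ((N : ℝ≥0∞) ^ d) ^ q * ∑ i ∈ cube a N, f i ^ q * W i

theorem rpow_inner_le {ι : Type*} (s : Finset ι) {q : ℝ} (hq : 1 ≤ q) (v f : ι → ℝ≥0∞) :
    (∑ i ∈ s, v i * f i) ^ q ≤ (∑ i ∈ s, v i) ^ (q - 1) * ∑ i ∈ s, v i * f i ^ q := by
  have hq0 : 0 < q := by linarith
  refine (ENNReal.rpow_le_rpow (ENNReal.inner_le_weight_mul_Lp_of_nonneg s hq v f) hq0.le).trans ?_
  rw [ENNReal.mul_rpow_of_nonneg _ _ hq0.le, ← ENNReal.rpow_mul, ← ENNReal.rpow_mul,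
    inv_mul_cancel₀ hq0.ne', ENNReal.rpow_one, sub_mul, one_mul, inv_mul_cancel₀ hq0.ne']

theorem rpow_tsum_le {ι : Type*} {q : ℝ} (hq : 1 ≤ q) (v f : ι → ℝ≥0∞) :
    (∑' i, v i * f i) ^ q ≤ (∑' i, v i) ^ (q - 1) * ∑' i, v i * f i ^ q := by
  have hq0 : 0 < q := by linarith
  rw [← ENNReal.le_rpow_inv_iff hq0, ENNReal.tsum_eq_iSup_sum (f := fun i => v i * f i)]
  refine iSup_le fun s => ?_
  rw [ENNReal.le_rpow_inv_iff hq0]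
  refine (rpow_inner_le s hq v f).trans ?_
  gcongr
  · exact ENNReal.sum_le_tsum s
  · exact ENNReal.sum_le_tsum s

/-- This form treats `q = 1` and `q > 1` alike. For `q > 1` it is Hölder's inequality with respect
to the dual weight `v = w ^ (-1/(q-1))`, applied to `f / v`; the factor `(∑ v) ^ (q - 1)` is then
absorbed by the Muckenhoupt condition. -/
theorem IsAqWeight.exists_bound {q : ℝ} (hq : 1 ≤ q) {w : Lattice d → ℝ} (hw : IsAqWeight q w) :
    ∃ C : ℝ≥0∞, C ≠ ∞ ∧ HasMuckenhouptBound q (fun i => ENNReal.ofReal (w i)) C := by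
  obtain ⟨hpos, h1, h2⟩ := hw
  rcases hq.eq_or_lt with rfl | hq1
  · obtain ⟨C, hC, h⟩ := h1 rfl
    refine ⟨ENNReal.ofReal C, ENNReal.ofReal_ne_top, fun a N hN f => ?_⟩
    have hNd : (0 : ℝ) < (N : ℝ) ^ d := by positivity
    simp only [ENNReal.rpow_one]
    rw [Finset.sum_mul, Finset.mul_sum]
    refine Finset.sum_le_sum fun j hj => ?_
    have h3 : ∑ i ∈ cube a N, w i ≤ C * (N : ℝ) ^ d * w j := by
      have := h a N hN j hj
      rw [cubeAvg, inv_mul_le_iff₀ hNd] at this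
      linarith
    rw [← ENNReal.ofReal_sum_of_nonneg fun i _ => (hpos i).le]
    calc f j * ENNReal.ofReal (∑ i ∈ cube a N, w i)
        ≤ f j * ENNReal.ofReal (C * (N : ℝ) ^ d * w j) := by gcongr
      _ = ENNReal.ofReal C * (N : ℝ≥0∞) ^ d * (f j * ENNReal.ofReal (w j)) := by
          rw [ENNReal.ofReal_mul (by positivity), ENNReal.ofReal_mul hC.le,
            ENNReal.ofReal_pow (by positivity), ENNReal.ofReal_natCast]
          ring
  · obtain ⟨C, hC, h⟩ := h2 hq1
    refine ⟨ENNReal.ofReal C, ENNReal.ofReal_ne_top, fun a N hN f => ?_⟩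
    have hNd : (0 : ℝ) < (N : ℝ) ^ d := by positivity
    have hq0 : 0 < q := by linarith
    have hq' : 0 < q - 1 := by linarith
    set v : Lattice d → ℝ := fun i => w i ^ (-(1 / (q - 1)))
    set u : Lattice d → ℝ := fun i => w i ^ (1 / (q - 1))
    have hv : ∀ i, 0 < v i := fun i => Real.rpow_pos_of_pos (hpos i) _
    have hu : ∀ i, 0 < u i := fun i => Real.rpow_pos_of_pos (hpos i) _
    have huv : ∀ i, v i * u i = 1 := fun i => by
      simp only [v, u]
      rw [← Real.rpow_add (hpos i)]
      simp
    have huvq : ∀ i, v i * u i ^ q = w i := fun i => by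
      simp only [v, u]
      rw [← Real.rpow_mul (hpos i).le, ← Real.rpow_add (hpos i)]
      have : -(1 / (q - 1)) + 1 / (q - 1) * q = 1 := by field_simp; ring
      rw [this, Real.rpow_one]
    have hA : (∑ i ∈ cube a N, f i) ^ q ≤ (∑ i ∈ cube a N, ENNReal.ofReal (v i)) ^ (q - 1) *
        ∑ i ∈ cube a N, f i ^ q * ENNReal.ofReal (w i) := by
      have := rpow_inner_le (cube a N) hq (fun i => ENNReal.ofReal (v i))
        (fun i => f i * ENNReal.ofReal (u i))
      convert this using 3 with i hi i hi
      · rw [mul_left_comm, ← ENNReal.ofReal_mul (hv i).le, huv]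
        simp
      · rw [ENNReal.mul_rpow_of_nonneg _ _ hq0.le, ENNReal.ofReal_rpow_of_pos (hu i),
          mul_left_comm, ← ENNReal.ofReal_mul (hv i).le, huvq]
    have hB : (∑ i ∈ cube a N, w i) * (∑ i ∈ cube a N, v i) ^ (q - 1) ≤
        C * ((N : ℝ) ^ d) ^ q := by
      have h3 := h a N hN
      have hv0 : 0 ≤ ∑ i ∈ cube a N, v i := Finset.sum_nonneg fun i _ => (hv i).le
      change ((N : ℝ) ^ d)⁻¹ * (∑ i ∈ cube a N, w i) *
        (((N : ℝ) ^ d)⁻¹ * ∑ i ∈ cube a N, v i) ^ (q - 1) ≤ C at h3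
      rw [Real.mul_rpow (by positivity) hv0, Real.inv_rpow hNd.le] at h3
      have h4 : ((N : ℝ) ^ d) ^ q = (N : ℝ) ^ d * ((N : ℝ) ^ d) ^ (q - 1) := by
        rw [← Real.rpow_one_add' hNd.le (by linarith)]
        ring_nf
      rw [h4]
      have h5 : 0 < ((N : ℝ) ^ d) ^ (q - 1) := Real.rpow_pos_of_pos hNd _
      field_simp at h3
      linarith
    have hB' : (∑ i ∈ cube a N, ENNReal.ofReal (w i)) *
        (∑ i ∈ cube a N, ENNReal.ofReal (v i)) ^ (q - 1) ≤
          ENNReal.ofReal C * ((N : ℝ≥0∞) ^ d) ^ q := by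
      have hw0 : 0 ≤ ∑ i ∈ cube a N, w i := Finset.sum_nonneg fun i _ => (hpos i).le
      have hv0 : 0 ≤ ∑ i ∈ cube a N, v i := Finset.sum_nonneg fun i _ => (hv i).le
      rw [← ENNReal.ofReal_sum_of_nonneg fun i _ => (hpos i).le,
        ← ENNReal.ofReal_sum_of_nonneg fun i _ => (hv i).le,
        ENNReal.ofReal_rpow_of_nonneg hv0 hq'.le, ← ENNReal.ofReal_mul hw0,
        ← ENNReal.ofReal_natCast, ← ENNReal.ofReal_pow (by positivity),
        ENNReal.ofReal_rpow_of_nonneg hNd.le hq0.le, ← ENNReal.ofReal_mul hC.le]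
      exact ENNReal.ofReal_le_ofReal hB
    calc _ ≤ ((∑ i ∈ cube a N, ENNReal.ofReal (v i)) ^ (q - 1) *
          ∑ i ∈ cube a N, f i ^ q * ENNReal.ofReal (w i)) *
            ∑ i ∈ cube a N, ENNReal.ofReal (w i) := by gcongr
      _ = ((∑ i ∈ cube a N, ENNReal.ofReal (w i)) *
            (∑ i ∈ cube a N, ENNReal.ofReal (v i)) ^ (q - 1)) *
              ∑ i ∈ cube a N, f i ^ q * ENNReal.ofReal (w i) := by ring
      _ ≤ _ := by gcongr

/-! ### Boundedness on weighted spaces -/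

/-- At cell side `m + 1`, a ball of radius `m` about a point of a cell stays within the adjacent
cells. The Muckenhoupt bound on that cube of three times the side gives `(3 ^ d) ^ q` from its
volume and `3 ^ d` from the overlap of these cubes. -/
theorem tsum_scale_le {q : ℝ} (hq : 1 ≤ q) {W : Lattice d → ℝ≥0∞} {C : ℝ≥0∞}
    (hW : HasMuckenhouptBound q W C) (f : Lattice d → ℝ≥0∞) (m : ℕ) :
    ∑' i, (∑' j, if size (i - j) ≤ m then f j else 0) ^ q * W i ≤
      (C * ((3 : ℝ≥0∞) ^ d) ^ q * 3 ^ d) * (((m + 1 : ℕ) : ℝ≥0∞) ^ d) ^ q *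
        ∑' i, f i ^ q * W i := by
  have hq0 : 0 ≤ q := by linarith
  have hN : 1 ≤ m + 1 := by omega
  rw [tsum_cell hN]
  calc _ ≤ ∑' n, (∑ j ∈ window (m + 1) n 1, f j) ^ q * ∑ i ∈ window (m + 1) n 1, W i := by
        refine ENNReal.tsum_le_tsum fun n => ?_
        rw [Finset.mul_sum]
        refine le_trans (Finset.sum_le_sum fun i hi => ?_)
          (Finset.sum_le_sum_of_subset (window_mono hN n zero_le_one))
        gcongr
        rw [sum_eq_tsum_ite]
        refine ENNReal.tsum_le_tsum fun j => ?_
        by_cases h : size (i - j) ≤ m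
        · have h1 := size_cell_sub_le hN j i
          rw [size_sub_comm j i, Nat.div_eq_of_lt (by omega)] at h1
          rw [(mem_window_zero hN).1 hi] at h1
          rw [if_pos h, if_pos ((mem_window hN).2 h1)]
        · simp [h]
    _ ≤ ∑' n, C * ((((2 * 1 + 1) * (m + 1) : ℕ) : ℝ≥0∞) ^ d) ^ q *
          ∑ i ∈ window (m + 1) n 1, f i ^ q * W i :=
        ENNReal.tsum_le_tsum fun n => hW _ _ (by omega) f
    _ = _ := by
        rw [ENNReal.tsum_mul_left, tsum_window hN, Nat.cast_mul, mul_pow,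
          ENNReal.mul_rpow_of_nonneg _ _ hq0]
        norm_num
        ring

/-- Layer-cake decomposition: the increments telescope, truncated subtraction being exact for an
antitone sequence, and the boundary term vanishes in the limit. -/
theorem antitone_le_tsum_diff {g : ℕ → ℝ≥0∞} (hg : Antitone g) (h0 : Tendsto g atTop (𝓝 0))
    (r : ℕ) : g r ≤ ∑' m, if r ≤ m then g m - g (m + 1) else 0 := by
  have h1 : ∀ L, g r ≤ ∑ k ∈ Finset.range L, (g (k + r) - g (k + r + 1)) + g (L + r) := by
    intro L
    induction L with
    | zero => simp
    | succ L ih =>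
      rw [Finset.sum_range_succ, add_assoc, show L + 1 + r = L + r + 1 by omega,
        tsub_add_cancel_of_le (hg (Nat.le_succ _))]
      exact ih
  have h2 : ∀ L, ∑ k ∈ Finset.range L, (g (k + r) - g (k + r + 1)) ≤
      ∑' m, if r ≤ m then g m - g (m + 1) else 0 := by
    intro L
    refine (ENNReal.sum_le_tsum _).trans ?_
    refine le_trans (le_of_eq (tsum_congr fun k => ?_))
      (ENNReal.tsum_comp_le_tsum_of_injective (add_left_injective r) _)
    simp
  have hlim := (tendsto_const_nhds (x := ∑' m, if r ≤ m then g m - g (m + 1) else 0)).add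
    ((tendsto_add_atTop_iff_nat r).2 h0)
  rw [add_zero] at hlim
  exact ge_of_tendsto' hlim fun L => (h1 L).trans (by gcongr; exact h2 L)

theorem tsum_diff_le_antitone {g : ℕ → ℝ≥0∞} (hg : Antitone g) (r : ℕ) :
    ∑' m, (if r ≤ m then g m - g (m + 1) else 0) ≤ g r := by
  have h : ∀ L, ∑ m ∈ Finset.range L, (if r ≤ m then g m - g (m + 1) else 0) + g (max r L) ≤
      g r := by
    intro L
    induction L with
    | zero => simp
    | succ L ih =>
      rw [Finset.sum_range_succ]
      by_cases hr : r ≤ L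
      · rw [if_pos hr, max_eq_right (by omega), add_assoc,
          tsub_add_cancel_of_le (hg (Nat.le_succ _))]
        rwa [max_eq_right hr] at ih
      · rw [if_neg hr, max_eq_left (by omega), add_zero]
        rwa [max_eq_left (by omega)] at ih
  exact ENNReal.tsum_le_of_sum_range_le fun L => le_self_add.trans (h L)

/-- A kernel with finite Beurling norm is bounded on weighted `ℓ^q` for Muckenhoupt weights. -/
theorem tsum_act_rpow_le (hd : 1 ≤ d) {q : ℝ} (hq : 1 ≤ q) {W : Lattice d → ℝ≥0∞} {C : ℝ≥0∞}
    (hW : HasMuckenhouptBound q W C) {F : Lattice d → Lattice d → ℝ≥0∞} (hF : kernelNorm F < ∞)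
    (f : Lattice d → ℝ≥0∞) :
    ∑' i, act F f i ^ q * W i ≤
      (C * ((3 : ℝ≥0∞) ^ d) ^ q * 3 ^ d) * kernelNorm F ^ q * ∑' i, f i ^ q * W i := by
  have hq0 : 0 ≤ q := by linarith
  set g := tail F
  have hg : Antitone g := tail_antitone F
  have hg0 : Tendsto g atTop (𝓝 0) := tail_tendsto_zero hd hF
  set K := C * ((3 : ℝ≥0∞) ^ d) ^ q * 3 ^ d
  set S := ∑' i, f i ^ q * W i
  let δ : ℕ → ℝ≥0∞ := fun m => g m - g (m + 1)
  let vol : ℕ → ℝ≥0∞ := fun m => ((m + 1 : ℕ) : ℝ≥0∞) ^ d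
  have hvol0 : ∀ m, vol m ≠ 0 := fun m => pow_ne_zero _ (by simp)
  have hvolt : ∀ m, vol m ≠ ∞ := fun m => ENNReal.pow_ne_top (ENNReal.natCast_ne_top _)
  let B : ℕ → Lattice d → ℝ≥0∞ := fun m i => ∑' j, if size (i - j) ≤ m then f j else 0
  -- The total mass of the layers is controlled because the cube `[0, m]^d`, of volume `vol m`, lies
  -- in the ball of radius `m`.
  have hP : ∑' m, δ m * vol m ≤ kernelNorm F := by
    calc ∑' m, δ m * vol m ≤ ∑' m, ∑' x : Lattice d, if size x ≤ m then δ m else 0 := by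
          refine ENNReal.tsum_le_tsum fun m => ?_
          refine le_trans ?_ (ENNReal.sum_le_tsum (cube 0 (m + 1)))
          refine le_trans (le_of_eq ?_)
            (Finset.sum_le_sum (f := fun _ => δ m) fun x hx => ?_)
          · rw [Finset.sum_const, card_cube, nsmul_eq_mul, mul_comm]
            simp [vol]
          · rw [if_pos]
            refine size_le_iff.2 fun l => ?_
            have := mem_cube.1 hx l
            simp only [Pi.zero_apply] at this
            omega
      _ = ∑' x : Lattice d, ∑' m, if size x ≤ m then δ m else 0 := ENNReal.tsum_comm
      _ ≤ kernelNorm F := ENNReal.tsum_le_tsum fun x => tsum_diff_le_antitone hg _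
  -- The action is dominated by a superposition of normalized ball sums with masses `δ m * vol m`.
  -- Hölder's inequality in `m` then reduces the bound to one scale at a time.
  have hact : ∀ i, act F f i ≤ ∑' m, δ m * vol m * ((vol m)⁻¹ * B m i) := by
    intro i
    calc act F f i ≤ ∑' j, (∑' m, if size (i - j) ≤ m then δ m else 0) * f j :=
          ENNReal.tsum_le_tsum fun j => by
            gcongr
            exact (le_tail F le_rfl).trans (antitone_le_tsum_diff hg hg0 _)
      _ = ∑' m, δ m * B m i := by
          simp only [B, ← ENNReal.tsum_mul_left, ← ENNReal.tsum_mul_right]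
          rw [ENNReal.tsum_comm]
          refine tsum_congr fun m => tsum_congr fun j => ?_
          split_ifs <;> simp
      _ = _ := tsum_congr fun m => by
          rw [mul_assoc, ← mul_assoc (vol m), ENNReal.mul_inv_cancel (hvol0 m) (hvolt m), one_mul]
  calc ∑' i, act F f i ^ q * W i
      ≤ ∑' i, (kernelNorm F ^ (q - 1) *
          ∑' m, δ m * vol m * ((vol m)⁻¹ * B m i) ^ q) * W i := by
        refine ENNReal.tsum_le_tsum fun i => ?_
        gcongr
        refine (ENNReal.rpow_le_rpow (hact i) hq0).trans ((rpow_tsum_le hq _ _).trans ?_)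
        gcongr
    _ = kernelNorm F ^ (q - 1) *
          ∑' m, δ m * vol m * ((vol m)⁻¹ ^ q * ∑' i, B m i ^ q * W i) := by
        simp only [← ENNReal.tsum_mul_left, ← ENNReal.tsum_mul_right]
        rw [ENNReal.tsum_comm]
        refine tsum_congr fun m => tsum_congr fun i => ?_
        rw [ENNReal.mul_rpow_of_nonneg _ _ hq0]
        ring
    _ ≤ kernelNorm F ^ (q - 1) * ∑' m, δ m * vol m * (K * S) := by
        refine mul_le_mul_right (ENNReal.tsum_le_tsum fun m => mul_le_mul_right ?_ _) _
        calc (vol m)⁻¹ ^ q * ∑' i, B m i ^ q * W i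
            ≤ (vol m)⁻¹ ^ q * (K * vol m ^ q * S) := by
              gcongr
              exact tsum_scale_le hq hW f m
          _ = ((vol m)⁻¹ * vol m) ^ q * (K * S) := by
              rw [ENNReal.mul_rpow_of_nonneg _ _ hq0]
              ring
          _ = K * S := by
              rw [ENNReal.inv_mul_cancel (hvol0 m) (hvolt m), ENNReal.one_rpow, one_mul]
    _ ≤ kernelNorm F ^ (q - 1) * (kernelNorm F * (K * S)) := by
        rw [ENNReal.tsum_mul_right]
        gcongr
    _ = K * kernelNorm F ^ q * S := by
        have : kernelNorm F ^ q = kernelNorm F ^ (q - 1) * kernelNorm F := by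
          conv_rhs => rw [← ENNReal.rpow_one (kernelNorm F), ← ENNReal.rpow_mul, one_mul]
          rw [← ENNReal.rpow_add_of_nonneg _ _ (by linarith) zero_le_one]
          ring_nf
        rw [this]
        ring

/-! ### Weighted norms of nonnegative sequences -/

/-- The weighted `ℓ^q`-norm of a nonnegative sequence. -/
def wnorm (q : ℝ) (W f : Lattice d → ℝ≥0∞) : ℝ≥0∞ := (∑' i, f i ^ q * W i) ^ (1 / q)

/-- The weighted `ℓ^q`-norm on a finite set. -/
def locNorm (q : ℝ) (W : Lattice d → ℝ≥0∞) (s : Finset (Lattice d)) (f : Lattice d → ℝ≥0∞) :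
    ℝ≥0∞ := (∑ i ∈ s, f i ^ q * W i) ^ (1 / q)

/-- Restriction of a nonnegative sequence to a finite set. -/
def restr (s : Finset (Lattice d)) (f : Lattice d → ℝ≥0∞) (i : Lattice d) : ℝ≥0∞ :=
  if i ∈ s then f i else 0

theorem wnorm_mono {q : ℝ} (hq : 1 ≤ q) (W : Lattice d → ℝ≥0∞) {f g : Lattice d → ℝ≥0∞}
    (h : ∀ i, f i ≤ g i) : wnorm q W f ≤ wnorm q W g := by
  unfold wnorm
  have : 0 ≤ q := by linarith
  gcongr
  exact h _

theorem wnorm_restr {q : ℝ} (hq : 1 ≤ q) (W : Lattice d → ℝ≥0∞) (s : Finset (Lattice d))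
    (f : Lattice d → ℝ≥0∞) : wnorm q W (restr s f) = locNorm q W s f := by
  have hq0 : 0 < q := by linarith
  rw [wnorm, locNorm, sum_eq_tsum_ite]
  congr 1
  refine tsum_congr fun i => ?_
  by_cases h : i ∈ s <;> simp [restr, h, hq0]

theorem wnorm_add_le {q : ℝ} (hq : 1 ≤ q) (W f g : Lattice d → ℝ≥0∞) :
    wnorm q W (fun i => f i + g i) ≤ wnorm q W f + wnorm q W g := by
  have hq0 : 0 < q := by linarith
  have hW : ∀ (h : Lattice d → ℝ≥0∞) i, h i ^ q * W i = (h i * W i ^ (1 / q)) ^ q := fun h i => by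
    rw [ENNReal.mul_rpow_of_nonneg _ _ hq0.le, ← ENNReal.rpow_mul, one_div_mul_cancel hq0.ne',
      ENNReal.rpow_one]
  unfold wnorm
  rw [ENNReal.tsum_eq_iSup_sum, one_div, ENNReal.rpow_inv_le_iff hq0]
  refine iSup_le fun s => ?_
  rw [← ENNReal.rpow_inv_le_iff hq0, ← one_div]
  have hfg := hW fun i => f i + g i
  simp only [add_mul] at hfg
  simp only [hW f, hW g, hfg]
  refine (ENNReal.Lp_add_le s _ _ hq).trans ?_
  gcongr
  · exact ENNReal.sum_le_tsum s
  · exact ENNReal.sum_le_tsum s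

theorem wnorm_zero {q : ℝ} (hq : 1 ≤ q) (W : Lattice d → ℝ≥0∞) :
    wnorm q W (fun _ => 0) = 0 := by
  have hq0 : 0 < q := by linarith
  simp [wnorm, hq0]

theorem wnorm_sum_le {q : ℝ} (hq : 1 ≤ q) (W : Lattice d → ℝ≥0∞) {ι : Type*} (s : Finset ι)
    (f : ι → Lattice d → ℝ≥0∞) :
    wnorm q W (fun i => ∑ m ∈ s, f m i) ≤ ∑ m ∈ s, wnorm q W (f m) := by
  classical
  induction s using Finset.induction_on with
  | empty => simp [wnorm_zero hq]
  | insert a s ha ih =>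
    simp only [Finset.sum_insert ha]
    exact (wnorm_add_le hq W _ _).trans (by gcongr)

theorem locNorm_le_mul {q : ℝ} (hq : 1 ≤ q) (W : Lattice d → ℝ≥0∞) {s : Finset (Lattice d)}
    {f : Lattice d → ℝ≥0∞} {M : ℝ≥0∞} (h : ∀ i ∈ s, f i ≤ M) :
    locNorm q W s f ≤ M * (∑ i ∈ s, W i) ^ (1 / q) := by
  have hq0 : 0 < q := by linarith
  rw [locNorm, one_div, ENNReal.rpow_inv_le_iff hq0, ENNReal.mul_rpow_of_nonneg _ _ hq0.le,
    ENNReal.rpow_inv_rpow hq0.ne', Finset.mul_sum]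
  refine Finset.sum_le_sum fun i hi => ?_
  gcongr
  exact h i hi

/-- The constant is independent of the kernel, so a commutator of small Beurling norm is a small
operator on the weighted space. -/
theorem exists_wnorm_act_le (hd : 1 ≤ d) {q : ℝ} (hq : 1 ≤ q) {W : Lattice d → ℝ≥0∞} {C : ℝ≥0∞}
    (hC : C ≠ ∞) (hW : HasMuckenhouptBound q W C) :
    ∃ K : ℝ≥0∞, K ≠ ∞ ∧ ∀ F : Lattice d → Lattice d → ℝ≥0∞, kernelNorm F < ∞ →
      ∀ f, wnorm q W (act F f) ≤ K * kernelNorm F * wnorm q W f := by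
  have hq0 : 0 < q := by linarith
  have h3 : (3 : ℝ≥0∞) ^ d ≠ ∞ := ENNReal.pow_ne_top (by simp)
  refine ⟨(C * ((3 : ℝ≥0∞) ^ d) ^ q * 3 ^ d) ^ (1 / q),
    ENNReal.rpow_ne_top_of_nonneg (by positivity)
      (ENNReal.mul_ne_top (ENNReal.mul_ne_top hC (ENNReal.rpow_ne_top_of_nonneg hq0.le h3)) h3),
    fun F hF f => ?_⟩
  unfold wnorm
  refine (ENNReal.rpow_le_rpow (tsum_act_rpow_le hd hq hW hF f) (by positivity)).trans ?_
  rw [ENNReal.mul_rpow_of_nonneg _ _ (by positivity : 0 ≤ 1 / q),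
    ENNReal.mul_rpow_of_nonneg _ _ (by positivity : 0 ≤ 1 / q), one_div,
    ENNReal.rpow_rpow_inv hq0.ne']

theorem HasMuckenhouptBound.sum_mul_le {q : ℝ} (hq : 1 ≤ q) {W : Lattice d → ℝ≥0∞} {C : ℝ≥0∞}
    (hW : HasMuckenhouptBound q W C) (a : Lattice d) {N : ℕ} (hN : 1 ≤ N)
    (f : Lattice d → ℝ≥0∞) :
    (∑ i ∈ cube a N, f i) * (∑ i ∈ cube a N, W i) ^ (1 / q) ≤
      C ^ (1 / q) * (N : ℝ≥0∞) ^ d * locNorm q W (cube a N) f := by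
  have hq0 : 0 < q := by linarith
  have h := ENNReal.rpow_le_rpow (hW a N hN f) (by positivity : 0 ≤ 1 / q)
  have h1 : 0 ≤ 1 / q := by positivity
  rw [ENNReal.mul_rpow_of_nonneg _ _ h1, ENNReal.mul_rpow_of_nonneg _ _ h1,
    ENNReal.mul_rpow_of_nonneg _ _ h1, ← ENNReal.rpow_mul, ← ENNReal.rpow_mul,
    mul_one_div_cancel hq0.ne', ENNReal.rpow_one, ENNReal.rpow_one] at h
  exact h

/-- Test the Muckenhoupt bound on the indicator of the central cell. -/
theorem HasMuckenhouptBound.doubling {q : ℝ} (hq : 1 ≤ q) {W : Lattice d → ℝ≥0∞} {C : ℝ≥0∞}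
    (hW : HasMuckenhouptBound q W C) {N : ℕ} (hN : 1 ≤ N) (n : Lattice d) (R : ℕ) :
    (∑ i ∈ window N n R, W i) ^ (1 / q) ≤
      (C ^ (1 / q) * ((2 * R + 1 : ℕ) : ℝ≥0∞) ^ d) * (∑ i ∈ window N n 0, W i) ^ (1 / q) := by
  have hq0 : 0 < q := by linarith
  have hsub := window_mono hN n (Nat.zero_le R)
  have h := hW.sum_mul_le hq (fun l => (n l - R) * N) (N := (2 * R + 1) * N)
    (Nat.mul_pos (by omega) hN) (restr (window N n 0) 1)
  change (∑ i ∈ window N n R, restr (window N n 0) 1 i) * (∑ i ∈ window N n R, W i) ^ (1 / q) ≤ _ *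
    locNorm q W (window N n R) _ at h
  have h1 : ∑ i ∈ window N n R, restr (window N n 0) 1 i = (N : ℝ≥0∞) ^ d := by
    simp only [restr]
    rw [Finset.sum_ite_mem, Finset.inter_eq_right.2 hsub]
    simp [window, card_cube]
  have h2 : locNorm q W (window N n R) (restr (window N n 0) 1) =
      (∑ i ∈ window N n 0, W i) ^ (1 / q) := by
    rw [locNorm]
    congr 1
    have : ∀ i, restr (window N n 0) 1 i ^ q * W i = if i ∈ window N n 0 then W i else 0 := by
      intro i
      by_cases h : i ∈ window N n 0 <;> simp [restr, h, hq0]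
    simp only [this]
    rw [Finset.sum_ite_mem, Finset.inter_eq_right.2 hsub]
  rw [h1, h2, Nat.cast_mul, mul_pow] at h
  have hN0 : (N : ℝ≥0∞) ^ d ≠ 0 := pow_ne_zero _ (by simp; omega)
  have hNt : (N : ℝ≥0∞) ^ d ≠ ∞ := ENNReal.pow_ne_top (ENNReal.natCast_ne_top _)
  refine (ENNReal.mul_le_mul_iff_right hN0 hNt).1 (h.trans (le_of_eq ?_))
  ring

/-! ### Smooth cutoffs and commutators -/

/-- The lower corner of the cell with index `n`. -/
def corner (N : ℕ) (n : Lattice d) : Lattice d := fun l => N * n l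

theorem cell_corner {N : ℕ} (hN : 1 ≤ N) (n : Lattice d) : cell N (corner N n) = n := by
  funext l
  simp only [cell, corner]
  exact Int.mul_ediv_cancel_left _ (by omega)

/-- A Lipschitz cutoff function adapted to the cell with index `n`. -/
def tent (N : ℕ) (n i : Lattice d) : ℝ :=
  max 0 (min 1 (2 - (size (i - corner N n) : ℝ) / N))

theorem tent_nonneg (N : ℕ) (n i : Lattice d) : 0 ≤ tent N n i := le_max_left _ _

theorem tent_le_one (N : ℕ) (n i : Lattice d) : tent N n i ≤ 1 :=
  max_le zero_le_one (min_le_left _ _)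

theorem tent_eq_one {N : ℕ} (hN : 1 ≤ N) {n i : Lattice d} (h : i ∈ window N n 0) :
    tent N n i = 1 := by
  have h1 := le_size_cell_sub hN i (corner N n)
  rw [cell_corner hN, (mem_window_zero hN).1 h, sub_self, size_zero, Nat.le_zero,
    Nat.div_eq_zero_iff] at h1
  have h2 : (size (i - corner N n) : ℝ) / N ≤ 1 := by
    rw [div_le_one (by positivity)]
    exact_mod_cast (show size (i - corner N n) ≤ N by omega)
  rw [tent, min_eq_left (by linarith), max_eq_right zero_le_one]

theorem tent_eq_zero {N : ℕ} (hN : 1 ≤ N) {n i : Lattice d} (h : i ∉ window N n 2) :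
    tent N n i = 0 := by
  have h1 := size_cell_sub_le hN i (corner N n)
  rw [cell_corner hN] at h1
  rw [mem_window hN] at h
  have h3 : 2 ≤ size (i - corner N n) / N := by omega
  rw [Nat.le_div_iff_mul_le hN] at h3
  have h4 : (2 : ℝ) ≤ (size (i - corner N n) : ℝ) / N := by
    rw [le_div_iff₀ (by positivity)]
    exact_mod_cast h3
  rw [tent, min_eq_right (by linarith), max_eq_left (by linarith)]

theorem abs_tent_sub_le (N : ℕ) (n i j : Lattice d) :
    |tent N n j - tent N n i| ≤ min 1 ((size (i - j) : ℝ) / N) := by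
  refine le_min ?_ ?_
  · rw [abs_le]
    constructor <;> linarith [tent_nonneg N n i, tent_nonneg N n j, tent_le_one N n i,
      tent_le_one N n j]
  · have h1 : |(size (i - corner N n) : ℝ) / N - (size (j - corner N n) : ℝ) / N| ≤
        (size (i - j) : ℝ) / N := by
      rw [← sub_div, abs_div, Nat.abs_cast]
      gcongr
      have h1 := size_sub_le i j (corner N n)
      have h2 := size_sub_le j i (corner N n)
      rw [size_sub_comm j i] at h2
      rw [abs_le]
      constructor
      · rw [neg_le_sub_iff_le_add]; exact_mod_cast (by omega)
      · rw [sub_le_iff_le_add]; exact_mod_cast h1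
    refine (abs_max_sub_max_le_max _ _ _ _).trans ?_
    rw [sub_self, abs_zero, max_eq_right (abs_nonneg _)]
    refine (abs_min_sub_min_le_max _ _ _ _).trans ?_
    rw [sub_self, abs_zero, max_eq_right (abs_nonneg _)]
    refine le_trans (le_of_eq ?_) h1
    ring_nf

/-- The majorant of the commutators with cutoff functions at scale `N`. -/
def commKernel (F : Lattice d → Lattice d → ℝ≥0∞) (N : ℕ) (i j : Lattice d) : ℝ≥0∞ :=
  F i j * min 1 ((size (i - j) : ℝ≥0∞) / N)

theorem commKernel_le (F : Lattice d → Lattice d → ℝ≥0∞) (N : ℕ) (i j : Lattice d) :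
    commKernel F N i j ≤ F i j :=
  (mul_le_mul' le_rfl (min_le_left _ _)).trans (mul_one _).le

theorem tendsto_natSqrt : Tendsto Nat.sqrt atTop atTop :=
  tendsto_atTop.2 fun b => (eventually_ge_atTop (b * b)).mono fun _ hn => Nat.le_sqrt.2 hn

theorem tail_zero_le (F : Lattice d → Lattice d → ℝ≥0∞) : tail F 0 ≤ kernelNorm F := by
  refine le_trans (le_of_eq ?_) (ENNReal.le_tsum (0 : Lattice d))
  rw [size_zero]

theorem tendsto_kernelNorm_commKernel (hd : 1 ≤ d) {F : Lattice d → Lattice d → ℝ≥0∞}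
    (hF : kernelNorm F < ∞) : Tendsto (fun N => kernelNorm (commKernel F N)) atTop (𝓝 0) := by
  refine tendsto_tsum_zero (fun k => tail F (size k)) hF.ne (fun N k => ?_) fun k => ?_
  · exact tail_le fun i j hij => (commKernel_le F N i j).trans (le_tail F hij)
  · have h0 := tail_tendsto_zero hd hF
    -- Split at distance `√N`: nearer entries gain a factor at most `1 / √N` from the cutoff,
    -- farther ones are bounded by the tail of `F`.
    have h1 : Tendsto (fun N : ℕ => tail F 0 * ((Nat.sqrt N : ℕ) : ℝ≥0∞)⁻¹ + tail F (Nat.sqrt N))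
        atTop (𝓝 (tail F 0 * 0 + 0)) :=
      (ENNReal.Tendsto.const_mul (ENNReal.tendsto_inv_nat_nhds_zero.comp tendsto_natSqrt)
        (Or.inr ((tail_zero_le F).trans_lt hF).ne)).add (h0.comp tendsto_natSqrt)
    rw [mul_zero, add_zero] at h1
    refine tendsto_of_tendsto_of_tendsto_of_le_of_le tendsto_const_nhds h1 (fun _ => zero_le)
      fun N => tail_le fun i j _ => ?_
    rcases le_total (Nat.sqrt N) (size (i - j)) with h | h
    · exact ((commKernel_le F N i j).trans (le_tail F h)).trans le_add_self
    · refine le_trans ?_ le_self_add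
      rw [commKernel]
      refine mul_le_mul' (le_tail F (Nat.zero_le _)) ((min_le_right _ _).trans ?_)
      rcases Nat.eq_zero_or_pos (Nat.sqrt N) with h2 | h2
      · simp [h2]
      · have h3 : Nat.sqrt N * Nat.sqrt N ≤ N := Nat.sqrt_le N
        have h4 : ((Nat.sqrt N : ℕ) : ℝ≥0∞) ≠ 0 := by exact_mod_cast h2.ne'
        have h5 : ((Nat.sqrt N : ℕ) : ℝ≥0∞) ≠ ∞ := ENNReal.natCast_ne_top _
        calc (size (i - j) : ℝ≥0∞) / N
            ≤ (Nat.sqrt N : ℕ) / ((Nat.sqrt N : ℕ) * (Nat.sqrt N : ℕ)) := by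
              gcongr
              exact_mod_cast h3
          _ = ((Nat.sqrt N : ℕ) : ℝ≥0∞)⁻¹ := by
              rw [div_eq_mul_inv, ENNReal.mul_inv (Or.inl h4) (Or.inl h5), ← mul_assoc,
                ENNReal.mul_inv_cancel h4 h5, one_mul]

/-- The sampled tail at scale `N`, away from the diagonal. -/
def sampledTail (F : Lattice d → Lattice d → ℝ≥0∞) (N : ℕ) (r : ℕ) : ℝ≥0∞ :=
  (N : ℝ≥0∞) ^ d * tail F (N * (max r 6 - 3))

theorem sampledTail_antitone (F : Lattice d → Lattice d → ℝ≥0∞) (N : ℕ) :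
    Antitone (sampledTail F N) := fun r s h => by
  unfold sampledTail
  gcongr
  exact tail_antitone F (Nat.mul_le_mul_left _ (by omega))

theorem tendsto_tsum_sampledTail (hd : 1 ≤ d) {F : Lattice d → Lattice d → ℝ≥0∞}
    (hF : kernelNorm F < ∞) :
    Tendsto (fun N => ∑' k : Lattice d, sampledTail F N (size k)) atTop (𝓝 0) := by
  have h0 : Tendsto (fun N : ℕ => ∑' y : Lattice d, tail F (max (size y) N)) atTop (𝓝 0) := by
    refine tendsto_tsum_zero (fun k => tail F (size k)) hF.ne
      (fun N k => tail_antitone F (le_max_left _ _)) fun k => ?_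
    exact tendsto_of_tendsto_of_tendsto_of_le_of_le tendsto_const_nhds (tail_tendsto_zero hd hF)
      (fun _ => zero_le) fun N => tail_antitone F (le_max_right _ _)
  have h1 := ENNReal.Tendsto.const_mul (a := ((2 * 4 : ℕ) : ℝ≥0∞) ^ d) h0
    (Or.inr (ENNReal.pow_ne_top (ENNReal.natCast_ne_top _)))
  rw [mul_zero] at h1
  refine tendsto_of_tendsto_of_tendsto_of_le_of_le' tendsto_const_nhds h1
    (Eventually.of_forall fun _ => zero_le) ?_
  filter_upwards [eventually_ge_atTop 1] with N hN
  refine le_trans ?_ (tsum_size_div_le (fun r => tail F (max r N)) (by norm_num : 1 ≤ 4))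
  rw [tsum_cell hN fun x => tail F (max (size x / 4) N)]
  refine ENNReal.tsum_le_tsum fun k => ?_
  -- The factor `N ^ d` counts the points of a cell, so the sampled sum becomes a sum over the
  -- lattice itself. A point of cell `k` has size below `N * (size k + 1)`, which is at most `4 * N
  -- * (max (size k) 6 - 3)`; this is the source of the rescaling by `4`.
  have hc : (N : ℝ≥0∞) ^ d * tail F (N * (max (size k) 6 - 3)) =
      ∑ _i ∈ window N k 0, tail F (N * (max (size k) 6 - 3)) := by
    rw [Finset.sum_const, window, card_cube, nsmul_eq_mul]
    simp
  rw [sampledTail, hc]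
  refine Finset.sum_le_sum fun x hx => tail_antitone F (max_le ?_ ?_)
  · have h2 := le_size_cell_sub hN x 0
    have h3 : cell N (0 : Lattice d) = 0 := by
      funext l
      simp [cell]
    rw [(mem_window_zero hN).1 hx, h3, sub_zero, sub_zero] at h2
    have h4 := Nat.lt_mul_of_div_lt (Nat.lt_succ_of_le h2) hN
    have h5 : N * (size k + 1) ≤ N * (4 * (max (size k) 6 - 3)) :=
      Nat.mul_le_mul_left _ (by omega)
    have h6 : N * (4 * (max (size k) 6 - 3)) = 4 * (N * (max (size k) 6 - 3)) := by ring
    have h7 : (size k).succ * N = N * (size k + 1) := by rw [Nat.succ_eq_add_one, mul_comm]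
    omega
  · exact Nat.le_mul_of_pos_right _ (by omega)

theorem summable_mul_of_bounded {A : InfMatrix d} (hA : A ∈ beurlingClass d) {c : Lattice d → ℂ}
    {M : ℝ≥0∞} (hM : M ≠ ∞) (hc : ∀ i, ‖c i‖ₑ ≤ M) (i : Lattice d) :
    Summable fun j => A i j * c j := by
  refine Summable.of_enorm (ne_of_lt ?_)
  have hA' : kernelNorm (fun i j => ‖A i j‖ₑ) < ∞ := by rw [← beurlingNorm_eq]; exact hA
  calc ∑' j, ‖A i j * c j‖ₑ ≤ ∑' j, ‖A i j‖ₑ * M :=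
        ENNReal.tsum_le_tsum fun j => by rw [enorm_mul]; gcongr; exact hc j
    _ = (∑' j, ‖A i j‖ₑ) * M := ENNReal.tsum_mul_right
    _ < ∞ := ENNReal.mul_lt_top ((tsum_row_le (fun i j => ‖A i j‖ₑ) i).trans_lt hA') hM.lt_top

/-- Write `A(φc) = φ Ac + [A, φ]c` with `φ` the cutoff. For `j` in the larger window the Lipschitz
bound controls the commutator. Outside it `φ(j) = 0`, so the remaining term carries `φ(i)` and lives
on the small window. -/
theorem enorm_apply_tent_mul_le {A : InfMatrix d} {c : Lattice d → ℂ}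
    (hs : ∀ i, Summable fun j => A i j * c j) {N : ℕ} (hN : 1 ≤ N) (n i : Lattice d) :
    ‖apply A (fun j => (tent N n j : ℂ) * c j) i‖ₑ ≤
      restr (window N n 2) (fun i => ‖apply A c i‖ₑ) i +
      act (commKernel (fun i j => ‖A i j‖ₑ) N) (restr (window N n 5) fun j => ‖c j‖ₑ) i +
      restr (window N n 2)
        (fun i => ∑' j, if j ∈ window N n 5 then 0 else ‖A i j‖ₑ * ‖c j‖ₑ) i := by
  have hs1 : Summable fun j => A i j * ((tent N n j : ℂ) * c j) := by
    refine summable_of_hasFiniteSupport ((window N n 2).finite_toSet.subset fun j hj => ?_)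
    by_contra h
    exact hj (by simp [tent_eq_zero hN h])
  have hs2 : Summable fun j => (tent N n i : ℂ) * (A i j * c j) := (hs i).mul_left _
  have heq : apply A (fun j => (tent N n j : ℂ) * c j) i = (tent N n i : ℂ) * apply A c i +
      ∑' j, (A i j * ((tent N n j - tent N n i : ℝ) : ℂ)) * c j := by
    have : ∀ j, (A i j * ((tent N n j - tent N n i : ℝ) : ℂ)) * c j =
        A i j * ((tent N n j : ℂ) * c j) - (tent N n i : ℂ) * (A i j * c j) := fun j => by
      push_cast
      ring
    simp only [this]
    rw [hs1.tsum_sub hs2, tsum_mul_left]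
    simp only [apply]
    ring
  have htent : ∀ j, ‖(tent N n j : ℂ)‖ₑ ≤ 1 := fun j => by
    rw [← ofReal_norm, Complex.norm_real, Real.norm_of_nonneg (tent_nonneg _ _ _)]
    simpa using tent_le_one N n j
  have htent_sub : ∀ j, ‖((tent N n j - tent N n i : ℝ) : ℂ)‖ₑ ≤
      min 1 ((size (i - j) : ℝ≥0∞) / N) := fun j => by
    rw [← ofReal_norm, Complex.norm_real, Real.norm_eq_abs]
    refine (ENNReal.ofReal_le_ofReal (abs_tent_sub_le N n i j)).trans (le_of_eq ?_)
    rw [ENNReal.ofReal_min, ENNReal.ofReal_one, ENNReal.ofReal_div_of_pos (by positivity),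
      ENNReal.ofReal_natCast, ENNReal.ofReal_natCast]
  rw [heq, add_assoc]
  refine (enorm_add_le _ _).trans (add_le_add ?_ ?_)
  · by_cases hi : i ∈ window N n 2
    · rw [restr, if_pos hi, enorm_mul]
      exact (mul_le_mul' (htent i) le_rfl).trans (one_mul _).le
    · simp [tent_eq_zero hN hi]
  · have hr : restr (window N n 2)
        (fun i => ∑' j, if j ∈ window N n 5 then 0 else ‖A i j‖ₑ * ‖c j‖ₑ) i =
        ∑' j, restr (window N n 2)
          (fun i => if j ∈ window N n 5 then 0 else ‖A i j‖ₑ * ‖c j‖ₑ) i := by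
      by_cases hi : i ∈ window N n 2 <;> simp [restr, hi]
    rw [hr, act, ← ENNReal.tsum_add]
    refine enorm_tsum_le_tsum_enorm.trans (ENNReal.tsum_le_tsum fun j => ?_)
    rw [enorm_mul, enorm_mul]
    by_cases hj : j ∈ window N n 5
    · refine le_trans ?_ le_self_add
      rw [restr, if_pos hj, commKernel]
      gcongr
      exact htent_sub j
    · refine le_trans ?_ le_add_self
      have hj2 : j ∉ window N n 2 := fun h => hj (window_mono hN n (by norm_num) h)
      rw [tent_eq_zero hN hj2]
      by_cases hi : i ∈ window N n 2
      · rw [restr, if_pos hi, if_neg hj]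
        gcongr
        refine (mul_le_mul' le_rfl ?_).trans (mul_one _).le
        simpa using htent i
      · simp [tent_eq_zero hN hi]

theorem tsum_far_le (F : Lattice d → Lattice d → ℝ≥0∞) (f : Lattice d → ℝ≥0∞) {N : ℕ} (hN : 1 ≤ N)
    {n i : Lattice d} (hi : i ∈ window N n 2) :
    ∑' j, (if j ∈ window N n 5 then 0 else F i j * f j) ≤
      ∑' m, tail F (N * (max (size (n - m)) 6 - 3)) * ∑ j ∈ window N m 0, f j := by
  rw [tsum_cell hN]
  refine ENNReal.tsum_le_tsum fun m => ?_
  rw [Finset.mul_sum]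
  refine Finset.sum_le_sum fun j hj => ?_
  by_cases h : j ∈ window N n 5
  · simp [h]
  rw [if_neg h]
  gcongr
  refine le_tail F ?_
  rw [mem_window hN, (mem_window_zero hN).1 hj] at h
  rw [mem_window hN] at hi
  have h1 := size_cell_sub_le hN i j
  rw [(mem_window_zero hN).1 hj] at h1
  have h2 := size_sub_le n (cell N i) m
  rw [size_sub_comm n (cell N i)] at h2
  rw [size_sub_comm m n] at h
  -- Cell `m` lies outside radius `5`, so its index distance from `n` is at least `6`. Of the `3`
  -- lost, `2` come from the position of `i` in the small window and `1` from rounding to cells.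
  have h3 : max (size (n - m)) 6 - 3 ≤ size (i - j) / N := by omega
  rw [Nat.le_div_iff_mul_le hN] at h3
  rwa [mul_comm]

/-! ### Localization of a stability estimate -/

/-- The local estimate that follows from stability on finitely supported sequences. -/
theorem locNorm_cell_le {q : ℝ} (hq : 1 ≤ q) {W : Lattice d → ℝ≥0∞} {A : InfMatrix d}
    {C₁ K : ℝ≥0∞}
    (hK : ∀ F : Lattice d → Lattice d → ℝ≥0∞, kernelNorm F < ∞ →
      ∀ f, wnorm q W (act F f) ≤ K * kernelNorm F * wnorm q W f)
    (hA : kernelNorm (fun i j => ‖A i j‖ₑ) < ∞)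
    (hstab : ∀ c : Lattice d → ℂ, c.support.Finite →
      wnorm q W (fun i => ‖c i‖ₑ) ≤ C₁ * wnorm q W (fun i => ‖apply A c i‖ₑ))
    {c : Lattice d → ℂ} (hs : ∀ i, Summable fun j => A i j * c j) {N : ℕ} (hN : 1 ≤ N)
    (n : Lattice d) :
    locNorm q W (window N n 0) (fun i => ‖c i‖ₑ) ≤
      C₁ * (locNorm q W (window N n 2) (fun i => ‖apply A c i‖ₑ) +
        K * kernelNorm (commKernel (fun i j => ‖A i j‖ₑ) N) *
          ∑ m ∈ window 1 n 5, locNorm q W (window N m 0) (fun i => ‖c i‖ₑ) +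
        (∑' m, tail (fun i j => ‖A i j‖ₑ) (N * (max (size (n - m)) 6 - 3)) *
          ∑ j ∈ window N m 0, ‖c j‖ₑ) * (∑ i ∈ window N n 2, W i) ^ (1 / q)) := by
  set F : Lattice d → Lattice d → ℝ≥0∞ := fun i j => ‖A i j‖ₑ
  set f : Lattice d → ℝ≥0∞ := fun i => ‖c i‖ₑ
  have h1 : locNorm q W (window N n 0) f ≤ wnorm q W fun i => ‖(tent N n i : ℂ) * c i‖ₑ := by
    rw [← wnorm_restr hq]
    refine wnorm_mono hq W fun i => ?_
    by_cases hi : i ∈ window N n 0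
    · simp [restr, hi, tent_eq_one hN hi, f]
    · simp [restr, hi]
  have h2 := hstab (fun i => (tent N n i : ℂ) * c i)
    ((window N n 2).finite_toSet.subset fun j hj => by
      by_contra h
      exact hj (by simp [tent_eq_zero hN h]))
  have hcomm : kernelNorm (commKernel F N) < ∞ :=
    (kernelNorm_mono (commKernel_le F N)).trans_lt hA
  refine (h1.trans h2).trans (mul_le_mul_right ?_ _)
  refine (wnorm_mono hq W (enorm_apply_tent_mul_le hs hN n)).trans ?_
  refine (wnorm_add_le hq W _ _).trans (add_le_add ((wnorm_add_le hq W _ _).trans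
    (add_le_add ?_ ?_)) ?_)
  · rw [wnorm_restr hq]
  · refine (hK _ hcomm _).trans (mul_le_mul_right ?_ _)
    simp only [← wnorm_restr hq W (window N _ 0)]
    refine le_trans (wnorm_mono hq W fun i => ?_) (wnorm_sum_le hq W _ _)
    -- The window is a union of cells, so its norm is at most the sum of the cell norms.
    by_cases hi : i ∈ window N n 5
    · have hm : cell N i ∈ window 1 n 5 := mem_ball_iff.2 ((mem_window hN).1 hi)
      refine le_trans ?_ (Finset.single_le_sum (fun _ _ => zero_le) hm)
      rw [restr, restr, if_pos hi, if_pos ((mem_window_zero hN).2 rfl)]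
    · simp [restr, hi]
  · rw [wnorm_restr hq]
    exact locNorm_le_mul hq W fun i hi => tsum_far_le F f hN hi

/-- Stability of a matrix on finitely supported sequences yields a pointwise estimate
for all bounded sequences, with a kernel of finite Beurling norm. -/
theorem exists_kernel_pointwise_le (hd : 1 ≤ d) {q : ℝ} (hq : 1 ≤ q) {W : Lattice d → ℝ≥0∞}
    {C : ℝ≥0∞} (hC : C ≠ ∞) (hW : HasMuckenhouptBound q W C) (hW0 : ∀ i, W i ≠ 0)
    (hWt : ∀ i, W i ≠ ∞) {A : InfMatrix d} (hA : A ∈ beurlingClass d) {C₁ : ℝ≥0∞} (hC₁ : C₁ ≠ ∞)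
    (hstab : ∀ c : Lattice d → ℂ, c.support.Finite →
      wnorm q W (fun i => ‖c i‖ₑ) ≤ C₁ * wnorm q W (fun i => ‖apply A c i‖ₑ)) :
    ∃ H : Lattice d → Lattice d → ℝ≥0∞, kernelNorm H < ∞ ∧
      ∀ c : Lattice d → ℂ, (∃ M : ℝ≥0∞, M ≠ ∞ ∧ ∀ i, ‖c i‖ₑ ≤ M) →
        ∀ i, ‖c i‖ₑ ≤ act H (fun j => ‖apply A c j‖ₑ) i := by
  have hq0 : 0 < q := by linarith
  have hq1 : 0 ≤ 1 / q := by positivity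
  set F : Lattice d → Lattice d → ℝ≥0∞ := fun i j => ‖A i j‖ₑ with hFdef
  have hF : kernelNorm F < ∞ := by rw [hFdef, ← beurlingNorm_eq]; exact hA
  obtain ⟨K, hKt, hK⟩ := exists_wnorm_act_le hd hq hC hW
  set C' := C ^ (1 / q)
  have hC' : C' ≠ ∞ := ENNReal.rpow_ne_top_of_nonneg hq1 hC
  set D : ℝ≥0∞ := C' * ((2 * 5 + 1 : ℕ) : ℝ≥0∞) ^ d
  have hD : D ≠ ∞ := ENNReal.mul_ne_top hC' (ENNReal.pow_ne_top (ENNReal.natCast_ne_top _))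
  -- the radial majorant of the interaction between cells
  let v : ℕ → ℕ → ℝ≥0∞ := fun N r =>
    C₁ * D * (K * kernelNorm (commKernel F N) * (if r ≤ 5 then 1 else 0) + C' * sampledTail F N r)
  have hvanti : ∀ N, Antitone (v N) := fun N r s h => by
    simp only [v]
    gcongr
    · by_cases hs : s ≤ 5
      · simp [hs, h.trans hs]
      · simp [hs]
    · exact sampledTail_antitone F N h
  have hvsum : ∀ N, ∑' k : Lattice d, v N (size k) = C₁ * D *
      (K * kernelNorm (commKernel F N) * ((2 * 5 + 1 : ℕ) : ℝ≥0∞) ^ d +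
        C' * ∑' k : Lattice d, sampledTail F N (size k)) := fun N => by
    simp only [v]
    rw [ENNReal.tsum_mul_left, ENNReal.tsum_add, ENNReal.tsum_mul_left, ENNReal.tsum_mul_left]
    have := tsum_ball (d := d) 5 0 1
    rw [tsum_size_sub_left (fun r => if r ≤ 5 then (1 : ℝ≥0∞) else 0) 0] at this
    rw [this, mul_one]
  have hlim : Tendsto (fun N => (2 * 4 ^ d) * ∑' k : Lattice d, v N (size k)) atTop (𝓝 0) := by
    simp only [hvsum]
    have h11 : ((2 * 5 + 1 : ℕ) : ℝ≥0∞) ^ d ≠ ∞ := ENNReal.pow_ne_top (ENNReal.natCast_ne_top _)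
    have h4 : (2 * 4 ^ d : ℝ≥0∞) ≠ ∞ :=
      ENNReal.mul_ne_top (by simp) (ENNReal.pow_ne_top (by simp))
    have t1 := ENNReal.Tendsto.mul_const (b := ((2 * 5 + 1 : ℕ) : ℝ≥0∞) ^ d)
      (ENNReal.Tendsto.const_mul (a := K) (tendsto_kernelNorm_commKernel hd hF) (Or.inr hKt))
      (Or.inr h11)
    have t2 := ENNReal.Tendsto.const_mul (a := C') (tendsto_tsum_sampledTail hd hF) (Or.inr hC')
    have t3 := ENNReal.Tendsto.const_mul (a := C₁ * D) (t1.add t2)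
      (Or.inr (ENNReal.mul_ne_top hC₁ hD))
    have t4 := ENNReal.Tendsto.const_mul (a := 2 * 4 ^ d) t3 (Or.inr h4)
    simpa using t4
  -- The scale is fixed here: `C₁`, `D`, `K` and `C'` do not depend on `N`, while the commutator
  -- norm and the sampled tails tend to zero.
  obtain ⟨N, hN, hNv⟩ : ∃ N, 1 ≤ N ∧ (2 * 4 ^ d) * ∑' k : Lattice d, v N (size k) ≤ 2⁻¹ :=
    ((eventually_ge_atTop 1).and (hlim.eventually_le_const (by simp))).exists
  let V : Lattice d → Lattice d → ℝ≥0∞ := fun n m => v N (size (n - m))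
  have hV : (2 * 4 ^ d) * kernelNorm V ≤ 2⁻¹ :=
    (mul_le_mul_right (kernelNorm_le_tsum (hvanti N) fun _ _ => le_rfl) _).trans hNv
  let ball : Lattice d → Lattice d → ℝ≥0∞ := fun m n => if size (m - n) ≤ 2 then 1 else 0
  have hball : kernelNorm ball < ∞ := by
    refine lt_of_le_of_lt (kernelNorm_le_tsum (h := fun r => if r ≤ 2 then 1 else 0)
      (fun r s h => ?_) fun _ _ => le_rfl) ?_
    · by_cases hs : s ≤ 2
      · simp [hs, h.trans hs]
      · simp [hs]
    · rw [← tsum_size_sub_left (fun r => if r ≤ 2 then (1 : ℝ≥0∞) else 0) 0, tsum_ball]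
      exact ENNReal.mul_lt_top (ENNReal.pow_lt_top (ENNReal.natCast_lt_top _)) ENNReal.one_lt_top
  let S := comp (neumann V) ball
  have hS : kernelNorm S < ∞ := by
    refine (kernelNorm_comp_le _ _).trans_lt (ENNReal.mul_lt_top (ENNReal.mul_lt_top
      (ENNReal.mul_lt_top (by simp) (ENNReal.pow_lt_top (by simp)))
      (kernelNorm_neumann_lt_top hV)) hball)
  let κ : ℝ≥0∞ := C' * (N : ℝ≥0∞) ^ d * (C₁ * D)
  have hκ : κ < ∞ := ENNReal.mul_lt_top (ENNReal.mul_lt_top hC'.lt_top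
    (ENNReal.pow_lt_top (ENNReal.natCast_lt_top _))) (ENNReal.mul_lt_top hC₁.lt_top hD.lt_top)
  -- The kernel is constant on pairs of cells. The Neumann series solves the inequality between
  -- cells, and `ball` records that the data for a cell are sums of `|Ac|` over its window of radius
  -- `2`.
  refine ⟨fun i j => κ * S (cell N i) (cell N j), ?_, ?_⟩
  · refine (kernelNorm_const_mul_le κ _).trans_lt (ENNReal.mul_lt_top hκ ?_)
    refine (kernelNorm_le_tsum (h := fun r => tail S (r / N)) (fun r s h =>
      tail_antitone S (Nat.div_le_div_right h)) fun i j =>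
        le_tail S (le_size_cell_sub hN i j)).trans_lt ?_
    refine (tsum_size_div_le (tail S) hN).trans_lt (ENNReal.mul_lt_top
      (ENNReal.pow_lt_top (ENNReal.natCast_lt_top _)) hS)
  rintro c ⟨M, hM, hc⟩ i
  have hs := summable_mul_of_bounded hA hM hc
  set f : Lattice d → ℝ≥0∞ := fun i => ‖c i‖ₑ
  set u : Lattice d → ℝ≥0∞ := fun i => ‖apply A c i‖ₑ
  let ω : Lattice d → ℝ≥0∞ := fun n => (∑ i ∈ window N n 0, W i) ^ (1 / q)
  have hsum0 : ∀ n, ∑ i ∈ window N n 0, W i ≠ 0 := fun n h => by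
    have := (Finset.sum_eq_zero_iff.1 h) (corner N n) ((mem_window_zero hN).2 (cell_corner hN n))
    exact hW0 _ this
  have hsumt : ∀ n, ∑ i ∈ window N n 0, W i ≠ ∞ := fun n =>
    ENNReal.sum_ne_top.2 fun i _ => hWt i
  have hω0 : ∀ n, ω n ≠ 0 := fun n => by
    simp only [ω, ne_eq, ENNReal.rpow_eq_zero_iff, hsum0 n, hsumt n, false_and, or_self,
      not_false_eq_true]
  have hωt : ∀ n, ω n ≠ ∞ := fun n => ENNReal.rpow_ne_top_of_nonneg hq1 (hsumt n)
  let α : Lattice d → ℝ≥0∞ := fun n => locNorm q W (window N n 0) f * (ω n)⁻¹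
  have hα : ∀ n, locNorm q W (window N n 0) f = α n * ω n := fun n => by
    simp only [α]
    rw [mul_assoc, ENNReal.inv_mul_cancel (hω0 n) (hωt n), mul_one]
  -- Normalizing by `ω` turns the sup bound on `c` into a bound uniform in the cell, as the Neumann
  -- argument requires.
  have hαM : ∀ n, α n ≤ M := fun n => by
    refine (ENNReal.mul_le_mul_iff_left (hω0 n) (hωt n)).1 ?_
    rw [← hα n]
    exact locNorm_le_mul hq W fun i _ => hc i
  have hsumα : ∀ m, ∑ j ∈ window N m 0, f j ≤ C' * (N : ℝ≥0∞) ^ d * α m := fun m => by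
    refine (ENNReal.mul_le_mul_iff_left (hω0 m) (hωt m)).1 ?_
    rw [mul_assoc, ← hα m]
    have h : (∑ j ∈ window N m 0, f j) * ω m ≤
        C' * (((2 * 0 + 1) * N : ℕ) : ℝ≥0∞) ^ d * locNorm q W (window N m 0) f :=
      hW.sum_mul_le hq _ (by omega) f
    rwa [show (2 * 0 + 1) * N = N by omega] at h
  have hdoub : ∀ n, (∑ i ∈ window N n 5, W i) ^ (1 / q) ≤ D * ω n := fun n =>
    hW.doubling hq hN n 5
  have hωD : ∀ n m, size (n - m) ≤ 5 → ω m ≤ D * ω n := fun n m hnm => by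
    refine le_trans ?_ (hdoub n)
    refine ENNReal.rpow_le_rpow (Finset.sum_le_sum_of_subset fun i hi => ?_) hq1
    rw [mem_window hN, (mem_window_zero hN).1 hi, size_sub_comm]
    exact hnm
  have hω2 : ∀ n, (∑ i ∈ window N n 2, W i) ^ (1 / q) ≤ D * ω n := fun n =>
    (ENNReal.rpow_le_rpow (Finset.sum_le_sum_of_subset (window_mono hN n (by norm_num))) hq1).trans
      (hdoub n)
  let β : Lattice d → ℝ≥0∞ := fun n => C₁ * D * ∑ j ∈ window N n 2, u j
  have hmain : ∀ n, α n ≤ β n + act V α n := fun n => by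
    refine (ENNReal.mul_le_mul_iff_left (hω0 n) (hωt n)).1 ?_
    rw [← hα n]
    refine (locNorm_cell_le hq hK hF hstab hs hN n).trans ?_
    have e1 : locNorm q W (window N n 2) u ≤ (∑ j ∈ window N n 2, u j) * (D * ω n) :=
      (locNorm_le_mul hq W fun i hi => Finset.single_le_sum (fun _ _ => zero_le) hi).trans
        (mul_le_mul_right (hω2 n) _)
    have e2 : ∑ m ∈ window 1 n 5, locNorm q W (window N m 0) f ≤
        (∑' m, (if size (n - m) ≤ 5 then 1 else 0) * α m) * (D * ω n) := by
      rw [sum_eq_tsum_ite, ← ENNReal.tsum_mul_right]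
      refine ENNReal.tsum_le_tsum fun m => ?_
      by_cases h : m ∈ window 1 n 5
      · have h5 : size (n - m) ≤ 5 := by rw [size_sub_comm]; exact mem_ball_iff.1 h
        rw [if_pos h, if_pos h5, one_mul, hα m]
        exact mul_le_mul_right (hωD n m h5) _
      · simp [h]
    -- Distant cells enter through plain sums, which `hsumα` bounds by `α m` with no weight left.
    -- Thus `ω m` and `ω n` are compared only for nearby cells, and the growth of doubling constants
    -- with distance never matters.
    have e3 : ∑' m, tail F (N * (max (size (n - m)) 6 - 3)) * ∑ j ∈ window N m 0, f j ≤
        ∑' m, C' * sampledTail F N (size (n - m)) * α m := by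
      refine ENNReal.tsum_le_tsum fun m => ?_
      refine (mul_le_mul_right (hsumα m) _).trans (le_of_eq ?_)
      rw [sampledTail]
      ring
    have e4 : act V α n = C₁ * D * (K * kernelNorm (commKernel F N) *
        (∑' m, (if size (n - m) ≤ 5 then 1 else 0) * α m) +
          ∑' m, C' * sampledTail F N (size (n - m)) * α m) := by
      rw [← ENNReal.tsum_mul_left, ← ENNReal.tsum_add, ← ENNReal.tsum_mul_left]
      refine tsum_congr fun m => ?_
      simp only [V, v]
      ring
    rw [e4]
    calc _ ≤ C₁ * ((∑ j ∈ window N n 2, u j) * (D * ω n) + K * kernelNorm (commKernel F N) *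
          ((∑' m, (if size (n - m) ≤ 5 then 1 else 0) * α m) * (D * ω n)) +
          (∑' m, C' * sampledTail F N (size (n - m)) * α m) * (D * ω n)) := by
          gcongr
          exact hω2 n
      _ = _ := by
          simp only [β]
          ring
  have hfin := le_act_neumann hV hM hαM hmain (cell N i)
  have hβ : ∀ n, β n = C₁ * D * act (fun n j => ball n (cell N j)) u n := fun n => by
    simp only [β, act, ball]
    rw [sum_eq_tsum_ite]
    congr 1
    refine tsum_congr fun j => ?_
    rw [size_sub_comm, ite_mul, one_mul, zero_mul]
    exact if_congr (mem_window hN) rfl rfl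
  calc f i ≤ ∑ j ∈ window N (cell N i) 0, f j :=
        Finset.single_le_sum (fun _ _ => zero_le) ((mem_window_zero hN).2 rfl)
    _ ≤ C' * (N : ℝ≥0∞) ^ d * act (neumann V) β (cell N i) :=
        (hsumα _).trans (mul_le_mul_right hfin _)
    _ = act (fun i j => κ * S (cell N i) (cell N j)) u i := by
        have h1 : act (neumann V) β (cell N i) = C₁ * D *
            ∑' j, S (cell N i) (cell N j) * u j := by
          simp only [act, S, comp, hβ, ← ENNReal.tsum_mul_left, ← ENNReal.tsum_mul_right]
          rw [ENNReal.tsum_comm]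
          refine tsum_congr fun j => tsum_congr fun m => ?_
          ring
        rw [h1, act, ← ENNReal.tsum_mul_left, ← ENNReal.tsum_mul_left]
        refine tsum_congr fun j => ?_
        simp only [κ]
        ring

/-! ### Algebra of matrices in the Beurling class -/

/-- The kernel of absolute values of a matrix. -/
def absKernel (A : InfMatrix d) (i j : Lattice d) : ℝ≥0∞ := ‖A i j‖ₑ

theorem mem_beurlingClass_iff {A : InfMatrix d} :
    A ∈ beurlingClass d ↔ kernelNorm (absKernel A) < ∞ := by
  change beurlingNorm A < ∞ ↔ _
  rw [beurlingNorm_eq]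
  rfl

theorem enorm_apply_le (A : InfMatrix d) (c : Lattice d → ℂ) (i : Lattice d) :
    ‖apply A c i‖ₑ ≤ act (absKernel A) (fun j => ‖c j‖ₑ) i := by
  refine enorm_tsum_le_tsum_enorm.trans (le_of_eq (tsum_congr fun j => ?_))
  rw [enorm_mul, absKernel]

theorem kernelNorm_comp_lt_top {F G : Lattice d → Lattice d → ℝ≥0∞} (hF : kernelNorm F < ∞)
    (hG : kernelNorm G < ∞) : kernelNorm (comp F G) < ∞ :=
  (kernelNorm_comp_le F G).trans_lt (ENNReal.mul_lt_top (ENNReal.mul_lt_top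
    (ENNReal.mul_lt_top (by simp) (ENNReal.pow_lt_top (by simp))) hF) hG)

theorem mul_mem_beurlingClass {A B : InfMatrix d} (hA : A ∈ beurlingClass d)
    (hB : B ∈ beurlingClass d) : mul A B ∈ beurlingClass d := by
  rw [mem_beurlingClass_iff] at *
  refine (kernelNorm_mono fun i j => ?_).trans_lt (kernelNorm_comp_lt_top hA hB)
  exact enorm_apply_le A (fun k => B k j) i

theorem conjTranspose_mem_beurlingClass {A : InfMatrix d} (hA : A ∈ beurlingClass d) :
    Aᴴ ∈ beurlingClass d := by
  rw [mem_beurlingClass_iff] at *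
  refine (kernelNorm_le_tsum (tail_antitone (absKernel A)) fun i j => ?_).trans_lt hA
  rw [size_sub_comm]
  refine le_trans (le_of_eq ?_) (le_tail (absKernel A) (i := j) (j := i) le_rfl)
  simp only [absKernel, Matrix.conjTranspose_apply]
  rw [← ofReal_norm, ← ofReal_norm, norm_star]

theorem apply_mul {A B : InfMatrix d} {c : Lattice d → ℂ} {i : Lattice d}
    (h : act (absKernel B) (act (absKernel A) fun j => ‖c j‖ₑ) i ≠ ∞) :
    apply (mul B A) c i = apply B (apply A c) i := by
  have hs : Summable (Function.uncurry fun j k => B i k * A k j * c j) := by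
    refine Summable.of_enorm ?_
    change ∑' p : Lattice d × Lattice d, ‖B i p.2 * A p.2 p.1 * c p.1‖ₑ ≠ ∞
    rw [ENNReal.tsum_prod (f := fun j k => ‖B i k * A k j * c j‖ₑ), ENNReal.tsum_comm]
    convert h using 1
    simp only [act, absKernel, ← ENNReal.tsum_mul_left, enorm_mul, mul_assoc]
  simp only [apply, mul, ← tsum_mul_left, ← tsum_mul_right]
  rw [← hs.tsum_comm]
  simp only [mul_assoc]

theorem act_act_ne_top_of_bounded {F G : Lattice d → Lattice d → ℝ≥0∞} (hF : kernelNorm F < ∞)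
    (hG : kernelNorm G < ∞) {f : Lattice d → ℝ≥0∞} {M : ℝ≥0∞} (hM : M ≠ ∞) (hf : ∀ i, f i ≤ M)
    (i : Lattice d) : act F (act G f) i ≠ ∞ := by
  have h : ∀ {F : Lattice d → Lattice d → ℝ≥0∞} {f : Lattice d → ℝ≥0∞} {M : ℝ≥0∞},
      (∀ i, f i ≤ M) → ∀ i, act F f i ≤ kernelNorm F * M := fun {F f M} hf i =>
    calc act F f i ≤ ∑' j, F i j * M := ENNReal.tsum_le_tsum fun j => by gcongr; exact hf j
      _ = (∑' j, F i j) * M := ENNReal.tsum_mul_right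
      _ ≤ kernelNorm F * M := by gcongr; exact tsum_row_le F i
  exact ((h (h hf) i).trans_lt
    (ENNReal.mul_lt_top hF (ENNReal.mul_lt_top hG hM.lt_top))).ne

theorem enorm_le_beurlingNorm (A : InfMatrix d) (i j : Lattice d) :
    ‖A i j‖ₑ ≤ kernelNorm (absKernel A) :=
  (le_tail (absKernel A) (Nat.zero_le _)).trans (tail_zero_le _)

theorem apply_mul_of_bounded {A B : InfMatrix d} (hA : A ∈ beurlingClass d)
    (hB : B ∈ beurlingClass d) {c : Lattice d → ℂ} {M : ℝ≥0∞} (hM : M ≠ ∞) (hc : ∀ i, ‖c i‖ₑ ≤ M) :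
    apply (mul B A) c = apply B (apply A c) :=
  funext fun i => apply_mul (act_act_ne_top_of_bounded (mem_beurlingClass_iff.1 hB)
    (mem_beurlingClass_iff.1 hA) hM hc i)

/-- The columns of `C` are bounded sequences, so this is compatibility of product and action, read
column by column. -/
theorem mul_assoc_of_mem {A B C : InfMatrix d} (hA : A ∈ beurlingClass d)
    (hB : B ∈ beurlingClass d) (hC : C ∈ beurlingClass d) : mul (mul A B) C = mul A (mul B C) := by
  funext i j
  exact congrFun (apply_mul_of_bounded hB hA (mem_beurlingClass_iff.1 hC).ne
    fun k => enorm_le_beurlingNorm C k j) i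

theorem isLeftInverse_iff {A B : InfMatrix d} (hA : A ∈ beurlingClass d)
    (hB : B ∈ beurlingClass d) : IsLeftInverse B A ↔ mul B A = 1 := by
  constructor
  · intro h
    funext i j
    exact (h i j).tsum_eq
  · intro h i j
    rw [← h]
    exact (summable_mul hB hA i j).hasSum

theorem conjTranspose_mul (A B : InfMatrix d) : (mul A B)ᴴ = mul Bᴴ Aᴴ := by
  funext i j
  simp only [Matrix.conjTranspose_apply, mul, tsum_star, star_mul]

theorem apply_one (c : Lattice d → ℂ) : apply (1 : InfMatrix d) c = c := by
  funext i
  rw [apply, tsum_eq_single i fun j hj => by rw [Matrix.one_apply_ne' hj, zero_mul]]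
  simp

/-! ### The Hilbert space case -/

theorem hasMuckenhouptBound_one : HasMuckenhouptBound (d := d) 2 1 1 := by
  intro a N hN f
  have h := rpow_inner_le (cube a N) one_le_two (fun _ => 1) f
  have h2 : ((N : ℝ≥0∞) ^ d) ^ (2 : ℝ) = (N : ℝ≥0∞) ^ d * (N : ℝ≥0∞) ^ d := by
    rw [ENNReal.rpow_two, sq]
  have h3 : (2 : ℝ) - 1 = 1 := by norm_num
  simp only [one_mul, Finset.sum_const, card_cube, nsmul_eq_mul, mul_one, Nat.cast_pow, h3,
    ENNReal.rpow_one] at h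
  simp only [Pi.one_apply, one_mul, Finset.sum_const, card_cube, nsmul_eq_mul, mul_one,
    Nat.cast_pow, h2]
  calc (∑ i ∈ cube a N, f i) ^ (2 : ℝ) * (N : ℝ≥0∞) ^ d
      ≤ ((N : ℝ≥0∞) ^ d * ∑ i ∈ cube a N, f i ^ (2 : ℝ)) * (N : ℝ≥0∞) ^ d := by gcongr
    _ = _ := by ring

/-- The Hilbert space of square-summable sequences on the lattice. -/
abbrev SqSum (d : ℕ) := lp (fun _ : Lattice d => ℂ) 2

theorem wnorm_two (f : Lattice d → ℝ≥0∞) :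
    wnorm 2 1 f = (∑' i, f i ^ (2 : ℝ)) ^ (1 / 2 : ℝ) := by simp [wnorm]

theorem memℓp_iff (c : Lattice d → ℂ) : Memℓp c 2 ↔ wnorm 2 1 (fun i => ‖c i‖ₑ) < ∞ := by
  rw [memℓp_gen_iff (by simp), wnorm_two, ENNReal.rpow_lt_top_iff_of_pos (by norm_num)]
  have h : ∀ i, ‖c i‖ₑ ^ (2 : ℝ) = ENNReal.ofReal (‖c i‖ ^ (2 : ℝ)) := fun i => by
    rw [← ofReal_norm, ENNReal.ofReal_rpow_of_nonneg (norm_nonneg _) (by norm_num)]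
  simp only [h, ENNReal.toReal_ofNat]
  constructor
  · intro hs
    exact hs.tsum_ofReal_lt_top
  · intro hs
    have := ENNReal.summable_toReal hs.ne
    refine this.congr fun i => ENNReal.toReal_ofReal (by positivity)

theorem enorm_sqSum (x : SqSum d) : ‖x‖ₑ = wnorm 2 1 fun i => ‖x i‖ₑ := by
  have hs : Summable fun i => ‖x i‖ ^ (2 : ℝ) := by
    have := (memℓp_gen_iff (by simp)).1 (lp.memℓp x)
    simpa using this
  have h := lp.norm_rpow_eq_tsum (p := 2) (by simp) x
  simp only [ENNReal.toReal_ofNat] at h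
  have h1 : ∀ i, ‖x i‖ₑ ^ (2 : ℝ) = ENNReal.ofReal (‖x i‖ ^ (2 : ℝ)) := fun i => by
    rw [← ofReal_norm, ENNReal.ofReal_rpow_of_nonneg (norm_nonneg _) (by norm_num)]
  rw [wnorm_two]
  simp only [h1]
  rw [← ENNReal.ofReal_tsum_of_nonneg (fun i => by positivity) hs, ← h,
    ← ENNReal.ofReal_rpow_of_nonneg (norm_nonneg _) (by norm_num), ofReal_norm, ← ENNReal.rpow_mul]
  norm_num

theorem enorm_sqSum_apply_le (x : SqSum d) (i : Lattice d) : ‖x i‖ₑ ≤ ‖x‖ₑ := by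
  rw [← ofReal_norm, ← ofReal_norm]
  exact ENNReal.ofReal_le_ofReal (lp.norm_apply_le_norm (by simp) x i)

theorem exists_wnorm_apply_le (hd : 1 ≤ d) {q : ℝ} (hq : 1 ≤ q) {W : Lattice d → ℝ≥0∞} {C : ℝ≥0∞}
    (hC : C ≠ ∞) (hW : HasMuckenhouptBound q W C) {A : InfMatrix d} (hA : A ∈ beurlingClass d) :
    ∃ K : ℝ≥0, ∀ c : Lattice d → ℂ,
      wnorm q W (act (absKernel A) fun i => ‖c i‖ₑ) ≤ K * wnorm q W (fun i => ‖c i‖ₑ) ∧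
      wnorm q W (fun i => ‖apply A c i‖ₑ) ≤ K * wnorm q W (fun i => ‖c i‖ₑ) := by
  obtain ⟨K, hKt, hK⟩ := exists_wnorm_act_le hd hq hC hW
  have hA' := mem_beurlingClass_iff.1 hA
  refine ⟨(K * kernelNorm (absKernel A)).toNNReal, fun c => ?_⟩
  rw [ENNReal.coe_toNNReal (ENNReal.mul_ne_top hKt hA'.ne)]
  exact ⟨hK _ hA' _, (wnorm_mono hq W (enorm_apply_le A c)).trans (hK _ hA' _)⟩

/-- A matrix in the Beurling class acts on square-summable sequences. -/
theorem exists_operator (hd : 1 ≤ d) {A : InfMatrix d} (hA : A ∈ beurlingClass d) :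
    ∃ T : SqSum d →L[ℂ] SqSum d, ∀ x i, T x i = apply A x i := by
  obtain ⟨K, hK⟩ := exists_wnorm_apply_le hd one_le_two ENNReal.one_ne_top
    hasMuckenhouptBound_one hA
  have hs : ∀ (x : SqSum d) i, Summable fun j => A i j * x j := fun x =>
    summable_mul_of_bounded hA enorm_ne_top (enorm_sqSum_apply_le x)
  have hmem : ∀ x : SqSum d, Memℓp (apply A x) 2 := fun x => by
    rw [memℓp_iff]
    refine (hK x).2.trans_lt ?_
    rw [← enorm_sqSum]
    exact ENNReal.mul_lt_top ENNReal.coe_lt_top enorm_lt_top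
  let L : SqSum d →ₗ[ℂ] SqSum d :=
    { toFun := fun x => ⟨apply A x, hmem x⟩
      map_add' := fun x y => by
        ext i
        simp only [apply, lp.coeFn_add, Pi.add_apply, mul_add]
        exact (hs x i).tsum_add (hs y i)
      map_smul' := fun a x => by
        ext i
        simp only [apply, lp.coeFn_smul, Pi.smul_apply, smul_eq_mul, RingHom.id_apply]
        rw [← tsum_mul_left]
        exact tsum_congr fun j => by ring }
  refine ⟨L.mkContinuous K fun x => ?_, fun x i => rfl⟩
  have h : ‖L x‖ₑ ≤ K * ‖x‖ₑ := by
    rw [enorm_sqSum, enorm_sqSum]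
    exact (hK x).2
  rw [enorm_eq_nnnorm, enorm_eq_nnnorm] at h
  exact_mod_cast h

theorem finset_sum_single_apply (s : Finset (Lattice d)) (x : SqSum d) {j : Lattice d}
    (hj : j ∉ s) : (∑ i ∈ s, lp.single 2 i (x i) : SqSum d) j = 0 := by
  rw [lp.coeFn_sum, Finset.sum_apply]
  refine Finset.sum_eq_zero fun i hi => ?_
  rw [lp.single_apply_ne]
  rintro rfl
  exact hj hi

/-- The Gram matrix of a matrix that is bounded below on finitely supported square-summable
sequences has a two-sided inverse in the Beurling class. -/
theorem exists_gram_inverse (hd : 1 ≤ d) {A : InfMatrix d} (hA : A ∈ beurlingClass d) {K : ℝ≥0}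
    (hK : ∀ c : Lattice d → ℂ, c.support.Finite →
      wnorm 2 1 (fun i => ‖c i‖ₑ) ≤ K * wnorm 2 1 (fun i => ‖apply A c i‖ₑ)) :
    ∃ G ∈ beurlingClass d, mul G (mul Aᴴ A) = 1 ∧ mul (mul Aᴴ A) G = 1 := by
  have hAH := conjTranspose_mem_beurlingClass hA
  have hD := mul_mem_beurlingClass hAH hA
  set D := mul Aᴴ A with hDdef
  obtain ⟨T, hT⟩ := exists_operator hd hA
  have hbelow : ∀ x : SqSum d, ‖x‖ ≤ K * ‖T x‖ := by
    intro x
    -- The lower bound passes from finitely supported sequences to all of `ℓ^2` by density and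
    -- continuity.
    have hclosed : IsClosed {x : SqSum d | ‖x‖ ≤ K * ‖T x‖} :=
      isClosed_le continuous_norm (continuous_const.mul T.continuous.norm)
    refine hclosed.mem_of_tendsto (lp.hasSum_single (by simp) x) (Eventually.of_forall fun s => ?_)
    have h := hK ((∑ i ∈ s, lp.single 2 i (x i) : SqSum d) : Lattice d → ℂ)
      (s.finite_toSet.subset fun j hj => by
        by_contra h
        exact hj (finset_sum_single_apply s x h))
    simp only [← hT] at h
    rw [← enorm_sqSum, ← enorm_sqSum, enorm_eq_nnnorm, enorm_eq_nnnorm] at h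
    change ‖(∑ i ∈ s, lp.single 2 i (x i) : SqSum d)‖ ≤ _
    exact_mod_cast h
  set P : SqSum d →L[ℂ] SqSum d := T.adjoint ∘L T with hPdef
  have hP : ∀ x i, P x i = apply D x i := by
    intro x i
    have h1 : P x i = inner ℂ (lp.single 2 i (1 : ℂ) : SqSum d) (P x) := by
      rw [lp.inner_single_left]
      simp
    rw [h1, hPdef, ContinuousLinearMap.comp_apply, ContinuousLinearMap.adjoint_inner_right,
      lp.inner_eq_tsum, hDdef, apply_mul_of_bounded hA hAH enorm_ne_top (enorm_sqSum_apply_le x)]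
    refine tsum_congr fun k => ?_
    rw [hT, hT, Matrix.conjTranspose_apply]
    have h2 : apply A (lp.single 2 i (1 : ℂ) : SqSum d) k = A k i := by
      rw [apply, tsum_eq_single i fun j hj => by rw [lp.single_apply_ne _ _ _ hj, mul_zero],
        lp.single_apply_self, mul_one]
    rw [h2]
    simp [mul_comm]
  -- Coercivity: `⟨Px, x⟩ = ‖Tx‖²` dominates a multiple of `‖x‖²`. Using `K + 1` keeps the constant
  -- meaningful when `K = 0`.
  have hunit : IsUnit P := by
    refine ContinuousLinearMap.isUnit_of_forall_le_norm_inner_map P (c := ((K + 1) ^ 2)⁻¹)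
      (by positivity) fun x => ?_
    have h1 : inner ℂ (P x) x = ((‖T x‖ ^ 2 : ℝ) : ℂ) := by
      rw [hPdef, ContinuousLinearMap.comp_apply, ContinuousLinearMap.adjoint_inner_left,
        inner_self_eq_norm_sq_to_K]
      simp
    rw [h1, Complex.norm_real, Real.norm_of_nonneg (by positivity)]
    push_cast
    rw [← div_eq_mul_inv, div_le_iff₀ (by positivity), ← mul_pow]
    gcongr
    have := hbelow x
    nlinarith [norm_nonneg (T x)]
  obtain ⟨U, hPU⟩ := hunit.exists_right_inv
  obtain ⟨U', hU'P⟩ := hunit.exists_left_inv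
  obtain rfl : U' = U := left_inv_eq_right_inv hU'P hPU
  have hPU : ∀ x, P (U' x) = x := fun x => congrArg (fun S : SqSum d →L[ℂ] SqSum d => S x) hPU
  have hUP : ∀ x, U' (P x) = x := fun x => congrArg (fun S : SqSum d →L[ℂ] SqSum d => S x) hU'P
  -- Second use of localization, now for the Gram matrix in unweighted `ℓ^2`, with the norm of the
  -- inverse operator as stability constant.
  obtain ⟨H, hH, hHle⟩ := exists_kernel_pointwise_le hd one_le_two ENNReal.one_ne_top
    (hasMuckenhouptBound_one (d := d)) (fun _ => one_ne_zero) (fun _ => ENNReal.one_ne_top) hD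
    (C₁ := ‖U'‖ₑ) enorm_ne_top fun c hc => by
      have hmem : Memℓp c 2 := memℓp_gen (summable_of_hasFiniteSupport
        (hc.subset fun i hi h => hi (by simp [h])))
      have h1 : ‖U' (P ⟨c, hmem⟩)‖ₑ ≤ ‖U'‖ₑ * ‖P ⟨c, hmem⟩‖ₑ := U'.le_opENorm _
      rw [hUP, enorm_sqSum, enorm_sqSum] at h1
      simpa only [hP] using h1
  let e : Lattice d → SqSum d := fun j => lp.single 2 j (1 : ℂ)
  let G : InfMatrix d := fun i j => U' (e j) i
  have hDG : ∀ j, apply D (fun k => G k j) = e j := fun j => by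
    funext i
    have := hP (U' (e j)) i
    rw [hPU] at this
    exact this.symm
  have he : ∀ i j, e j i = (1 : InfMatrix d) i j := fun i j => by
    simp only [e, lp.single_apply, Matrix.one_apply, Pi.single_apply]
  -- Column `j` of `G` is mapped by `D` to a unit vector, so the pointwise estimate collapses to
  -- `|G(i,j)| ≤ H(i,j)`.
  have hG : G ∈ beurlingClass d := by
    rw [mem_beurlingClass_iff]
    refine (kernelNorm_mono fun i j => ?_).trans_lt hH
    refine (hHle (fun k => G k j) ⟨_, enorm_ne_top, enorm_sqSum_apply_le (U' (e j))⟩ i).trans ?_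
    rw [hDG, act, tsum_eq_single j]
    · simp [e]
    · intro k hk
      rw [he, Matrix.one_apply_ne hk]
      simp
  have hDG' : mul D G = 1 := by
    funext i j
    rw [← he, ← hDG]
    rfl
  -- The inverse of a self-adjoint operator is self-adjoint; conjugate transposition then turns `DG
  -- = 1` into `GD = 1`.
  have hGH : Gᴴ = G := by
    funext i j
    have hsymm : ∀ x y, inner ℂ (P x) y = inner ℂ x (P y) := fun x y => by
      rw [hPdef, ContinuousLinearMap.comp_apply, ContinuousLinearMap.comp_apply,
        ContinuousLinearMap.adjoint_inner_left, ContinuousLinearMap.adjoint_inner_right]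
    have h1 : ∀ i (x : SqSum d), inner ℂ (e i) x = x i := fun i x => by
      rw [lp.inner_single_left]
      simp
    have h2 := hsymm (U' (e j)) (U' (e i))
    rw [hPU, hPU, h1, ← inner_conj_symm, h1] at h2
    have h3 : star (G j i) = star (star (G i j)) := congrArg star h2
    rw [star_star] at h3
    exact h3
  have hDH : Dᴴ = D := by
    rw [hDdef, conjTranspose_mul, Matrix.conjTranspose_conjTranspose]
  refine ⟨G, hG, ?_, hDG'⟩
  have := congrArg Matrix.conjTranspose hDG'
  rwa [conjTranspose_mul, hGH, hDH, Matrix.conjTranspose_one] at this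

/-! ### Stability in weighted spaces -/

theorem weightedNorm_eq (q : ℝ) (w : Lattice d → ℝ) (c : Lattice d → ℂ) :
    weightedNorm q w c = wnorm q (fun i => ENNReal.ofReal (w i)) (fun i => ‖c i‖ₑ) := rfl

/-- The pointwise estimate drawn from `ℓ^q_w` does not involve the weight, and its kernel is bounded
on `ℓ^2`; hence `A` is bounded below there on finitely supported sequences. -/
theorem HasStability.exists_gram_inverse (hd : 1 ≤ d) {q : ℝ} (hq : 1 ≤ q) {w : Lattice d → ℝ}
    (hw : IsAqWeight q w) {A : InfMatrix d} (hA : A ∈ beurlingClass d) (h : HasStability q w A) :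
    ∃ G ∈ beurlingClass d, mul G (mul Aᴴ A) = 1 ∧ mul (mul Aᴴ A) G = 1 := by
  have hq0 : 0 < q := by linarith
  obtain ⟨C, hC0, hC⟩ := h
  obtain ⟨Cw, hCw, hW⟩ := hw.exists_bound hq
  have hC0' : (C : ℝ≥0∞) ≠ 0 := by exact_mod_cast hC0.ne'
  obtain ⟨H, hH, hHle⟩ := exists_kernel_pointwise_le hd hq hCw hW
    (fun i => by simpa using hw.1 i) (fun _ => ENNReal.ofReal_ne_top) hA
    (C₁ := C) ENNReal.coe_ne_top fun c hc => by
      have hmem : c ∈ weightedSpace q w := by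
        refine ENNReal.rpow_lt_top_of_nonneg (by positivity) ?_
        rw [tsum_eq_sum (s := hc.toFinset) fun i hi => by
          have : c i = 0 := by simpa using hi
          simp [this, hq0]]
        exact ENNReal.sum_ne_top.2 fun i _ => ENNReal.mul_ne_top
          (ENNReal.rpow_ne_top_of_nonneg hq0.le enorm_ne_top) ENNReal.ofReal_ne_top
      exact (ENNReal.inv_mul_le_iff hC0' ENNReal.coe_ne_top).1 (hC c hmem).2.1
  obtain ⟨K, hKt, hK⟩ := exists_wnorm_act_le (d := d) hd one_le_two ENNReal.one_ne_top
    hasMuckenhouptBound_one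
  refine Beurling.exists_gram_inverse hd hA (K := (K * kernelNorm H).toNNReal) fun c hc => ?_
  rw [ENNReal.coe_toNNReal (ENNReal.mul_ne_top hKt hH.ne)]
  refine (wnorm_mono one_le_two 1 (hHle c ⟨∑ i ∈ hc.toFinset, ‖c i‖ₑ, ?_, fun i => ?_⟩)).trans
    (hK H hH _)
  · exact ENNReal.sum_ne_top.2 fun i _ => enorm_ne_top
  · by_cases hi : i ∈ hc.toFinset
    · exact Finset.single_le_sum (f := fun i => ‖c i‖ₑ) (fun _ _ => zero_le) hi
    · have : c i = 0 := by simpa using hi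
      simp [this]

/-- Sequences in a weighted space may be unbounded; this pointwise finiteness replaces boundedness
in the convergence arguments. -/
theorem ne_top_of_wnorm_lt_top {q : ℝ} (hq : 1 ≤ q) {W : Lattice d → ℝ≥0∞} {f : Lattice d → ℝ≥0∞}
    (h : wnorm q W f < ∞) {i : Lattice d} (hi : W i ≠ 0) : f i ≠ ∞ := by
  have hq0 : 0 < q := by linarith
  rw [wnorm, ENNReal.rpow_lt_top_iff_of_pos (by positivity)] at h
  intro hf
  have h1 := (ENNReal.le_tsum (f := fun i => f i ^ q * W i) i).trans_lt h
  simp [hf, ENNReal.top_rpow_of_pos hq0, ENNReal.top_mul hi] at h1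

theorem hasStability_of_isLeftInverse (hd : 1 ≤ d) {q : ℝ} (hq : 1 ≤ q) {w : Lattice d → ℝ}
    (hw : IsAqWeight q w) {A B : InfMatrix d} (hA : A ∈ beurlingClass d)
    (hB : B ∈ beurlingClass d) (h : mul B A = 1) : HasStability q w A := by
  obtain ⟨Cw, hCw, hW⟩ := hw.exists_bound hq
  obtain ⟨K₁, hK₁⟩ := exists_wnorm_apply_le hd hq hCw hW hA
  obtain ⟨K₂, hK₂⟩ := exists_wnorm_apply_le hd hq hCw hW hB
  obtain ⟨K, hKt, hK⟩ := exists_wnorm_act_le hd hq hCw hW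
  have hw0 : ∀ i, ENNReal.ofReal (w i) ≠ 0 := fun i => by simpa using hw.1 i
  refine ⟨K₁ + K₂ + 1, by positivity, fun c hc => ?_⟩
  have hc' : wnorm q (fun i => ENNReal.ofReal (w i)) (fun i => ‖c i‖ₑ) < ∞ := hc
  have hact := (hK₁ c).1.trans_lt (ENNReal.mul_lt_top ENNReal.coe_lt_top hc')
  have hC0 : ((K₁ + K₂ + 1 : ℝ≥0) : ℝ≥0∞) ≠ 0 := by
    have : (K₁ + K₂ + 1 : ℝ≥0) ≠ 0 := by positivity
    exact_mod_cast this
  refine ⟨fun i => Summable.of_enorm ?_, ?_, ?_⟩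
  · simp only [enorm_mul]
    exact ne_top_of_wnorm_lt_top hq hact (hw0 i)
  · rw [ENNReal.inv_mul_le_iff hC0 ENNReal.coe_ne_top, weightedNorm_eq, weightedNorm_eq]
    have hB' := mem_beurlingClass_iff.1 hB
    -- Regrouping `B(Ac)` as `(BA)c` needs absolute convergence of the double series, obtained by
    -- applying the weighted bound twice to absolute values.
    have hact2 := (hK (absKernel B) hB' (act (absKernel A) fun j => ‖c j‖ₑ)).trans_lt
      (ENNReal.mul_lt_top (ENNReal.mul_lt_top hKt.lt_top hB') hact)
    have hBA : apply B (apply A c) = c := by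
      funext i
      rw [← apply_mul (ne_top_of_wnorm_lt_top hq hact2 (hw0 i)), h, apply_one]
    have h2 := (hK₂ (apply A c)).2
    rw [hBA] at h2
    refine h2.trans (mul_le_mul_left ?_ _)
    exact_mod_cast (by rw [add_right_comm]; exact le_add_self : K₂ ≤ K₁ + K₂ + 1)
  · refine (hK₁ c).2.trans (mul_le_mul_left ?_ _)
    exact_mod_cast (by rw [add_assoc]; exact le_self_add : K₁ ≤ K₁ + K₂ + 1)

end Beurling

end

/-! ### Equivalence of stability and left invertibility. -/

theorem mainTheorem4 (d : ℕ) (hd : 1 ≤ d) (q : ℝ) (hq : 1 ≤ q)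
    (w : Beurling.Lattice d → ℝ) (hw : Beurling.IsAqWeight q w)
    (A : Beurling.InfMatrix d) (hA : A ∈ Beurling.beurlingClass d) :
    (Beurling.HasStability q w A ↔
      ∃ B ∈ Beurling.beurlingClass d, Beurling.IsLeftInverse B A) ∧
    (Beurling.HasStability q w A →
      ∃ G ∈ Beurling.beurlingClass d,
        Beurling.IsLeftInverse G (Beurling.mul Aᴴ A) ∧
        Beurling.IsLeftInverse (Beurling.mul Aᴴ A) G ∧
        Beurling.mul G Aᴴ ∈ Beurling.beurlingClass d ∧
        Beurling.IsLeftInverse (Beurling.mul G Aᴴ) A) := by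
  have hAH := Beurling.conjTranspose_mem_beurlingClass hA
  have hD := Beurling.mul_mem_beurlingClass hAH hA
  have key : Beurling.HasStability q w A →
      ∃ G ∈ Beurling.beurlingClass d,
        Beurling.IsLeftInverse G (Beurling.mul Aᴴ A) ∧
        Beurling.IsLeftInverse (Beurling.mul Aᴴ A) G ∧
        Beurling.mul G Aᴴ ∈ Beurling.beurlingClass d ∧
        Beurling.IsLeftInverse (Beurling.mul G Aᴴ) A := by
    intro h
    obtain ⟨G, hG, hGD, hDG⟩ := h.exists_gram_inverse hd hq hw hA
    have hGA := Beurling.mul_mem_beurlingClass hG hAH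
    refine ⟨G, hG, (Beurling.isLeftInverse_iff hD hG).2 hGD,
      (Beurling.isLeftInverse_iff hG hD).2 hDG, hGA, (Beurling.isLeftInverse_iff hA hGA).2 ?_⟩
    rw [Beurling.mul_assoc_of_mem hG hAH hA, hGD]
  refine ⟨⟨fun h => ?_, ?_⟩, key⟩
  · obtain ⟨G, -, -, -, hGA, hinv⟩ := key h
    exact ⟨_, hGA, hinv⟩
  · rintro ⟨B, hB, hBA⟩
    exact Beurling.hasStability_of_isLeftInverse hd hq hw hA hB
      ((Beurling.isLeftInverse_iff hA hB).1 hBA)
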